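/- Let $L\ge 3$, let $D=(\mathbb Z/L\mathbb Z)^2$ be the sites of the periodic square lattice with unit vectors $\delta_1,\delta_2$, let $P=\{x+\delta_l/2 : x\in D,\ l=1,2\}$ be the set of mid-points of its nearest-neighbour bonds ($|P|=2L^2$), and $\Lambda=D\cup P$. For $x\in D$ let $P_x$ be the set of $u\in P$ at distance $1/2$ from $x$, and for $u\in P$ let $D_u$ be the set of $x\in D$ at distance $1/2$ from $u$. Let $c_{i,\sigma}$ ($i\in\Lambda$, $\sigma\in\{\uparrow,\downarrow\}$) be the canonical fermion annihilation operators on the fermionic Fock space over $\Lambda\times\{\uparrow,\downarrow\}$, with vacuum $\Phi_0$ and $n_{i,\sigma}=c_{i,\sigma}^\dagger c_{i,\sigma}$. Let $\mathcal P_D=\prod_{x\in D}(1-n_{x,\uparrow}n_{x,\downarrow})$, and let $\mathbf H_{N_{\rm e}}$ be the span of all states $$\Big(\prod_{x\in A}c^\dagger_{x,\sigma_x}\Big)\Big(\prod_{u\in B_\uparrow}c^\dagger_{u,\uparrow}\Big)\Big(\prod_{u\in B_\downarrow}c^\dagger_{u,\downarrow}\Big)\Phi_0$$ with $A\subset D$,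 $\sigma_x\in\{\uparrow,\downarrow\}$, $B_\uparrow,B_\downarrow\subset P$ and $|A|+|B_\uparrow|+|B_\downarrow|=N_{\rm e}$. Let $\alpha,\beta\in\mathbb R$ with $\alpha\ne-\beta$, let $Q=(0,\pi)$, and put $$a_{u,\sigma}=c_{u,\sigma}+\alpha\sum_{x\in D_u}c_{x,\sigma},\qquad b_{x,\sigma}=c_{x,\sigma}+\beta\sum_{u\in P_x}c_{u,\sigma},\qquad d_{x,\sigma}=\sum_{u\in P_x}e^{-2iQ\cdot u}a_{u,\sigma},$$ $n^a_{u,\sigma}=a_{u,\sigma}^\dagger a_{u,\sigma}$, $n^b_{x,\sigma}=b_{x,\sigma}^\dagger b_{x,\sigma}$, $n^d_{x,\sigma}=d_{x,\sigma}^\dagger d_{x,\sigma}$. Write $-\sigma$ for the spin opposite to $\sigma$. Let $V_1,V_2>0$, $t=4(1+\alpha^2)V_1$, $W_1=\alpha^2V_1$, $s=(1+2\alpha^2)V_2$, $W_2=\alpha^2V_2$, and $$\begin{aligned}H=\mathcal P_D\Big(&t\sum_{x\in D}\sum_\sigma n^b_{x,\sigma}+s\sum_{u\in P}\sum_\sigma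 n_{u,\sigma}-V_1\sum_{x\in D}\sum_\sigma n^d_{x,-\sigma}n^b_{x,\sigma}-W_1\sum_{x\in D}\sum_{l=1,2}\sum_\sigma(n_{x+\delta_l,\sigma}+n_{x-\delta_l,\sigma})n^b_{x,\sigma}\\&-V_2\sum_{u\in P}\sum_\sigma n^a_{u,-\sigma}n_{u,\sigma}-W_2\sum_{u\in P}\sum_{x\in D_u}\sum_\sigma n_{x,\sigma}n_{u,\sigma}\Big)\mathcal P_D.\end{aligned}$$ Let $\zeta^\dagger=\sum_{u\in P}e^{2iQ\cdot u}a^\dagger_{u,\uparrow}a^\dagger_{u,\downarrow}$. The ground-state energy for $N_{\rm e}$ electrons is the lowest eigenvalue of $H$ on $\mathbf H_{N_{\rm e}}$, and a ground state is a nonzero eigenvector in $\mathbf H_{N_{\rm e}}$ with this eigenvalue. Theorem. Let $N_{\rm e}\le 2|P|$. If $N_{\rm e}$ is even, then the ground-state energy is $0$, the ground state is unique up to a scalar factor, and it is given by $$\Phi_{{\rm G},N_{\rm e}}=\mathcal P_D(\zeta^\dagger)^{N_{\rm e}/2}\Phi_0=(\mathcal P_D\zeta^\dagger)^{N_{\rm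 e}/2}\Phi_0 ,$$ which satisfies $H\Phi_{{\rm G},N_{\rm e}}=0$. If $N_{\rm e}$ is odd, then the ground-state energy is strictly positive. -/

import Mathlib

open scoped BigOperators

namespace CuO2

/-! ### Fermionic Fock space over a finite set of modes -/

section Fock

variable {M : Type*} [Fintype M] [DecidableEq M]

/-- The antisymmetric Fock space over the finite set of modes `M`. The coordinate `ψ S` is the
amplitude of the occupation configuration `S`. -/
abbrev Fock (M : Type*) [Fintype M] [DecidableEq M] : Type _ := EuclideanSpace ℂ (Finset M)

/-- The Jordan–Wigner sign `(-1)^{number of modes of S that precede m}`, with respect to a fixed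
enumeration of the modes. -/
noncomputable def jwSign (m : M) (S : Finset M) : ℂ :=
  (-1) ^ (S.filter fun k => Fintype.equivFin M k < Fintype.equivFin M m).card

/-- The annihilation operator of the mode `m`: it sends the configuration `insert m S`, with
`m ∉ S`, to `jwSign m S` times the configuration `S`, and kills the configurations without `m`. -/
noncomputable def annih (m : M) : Module.End ℂ (Fock M) where
  toFun ψ := WithLp.toLp 2 fun S => if m ∈ S then 0 else jwSign m S * ψ (insert m S)
  map_add' ψ φ := by
    ext S
    by_cases h : m ∈ S <;> simp [h, mul_add]
  map_smul' c ψ := by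
    ext S
    by_cases h : m ∈ S <;> simp [h, mul_left_comm]

/-- The Hermitian adjoint of an operator on Fock space. -/
noncomputable def dag (T : Module.End ℂ (Fock M)) : Module.End ℂ (Fock M) :=
  LinearMap.adjoint T

/-- The vacuum (the state without particles). -/
noncomputable def vacuum : Fock M := EuclideanSpace.single ∅ 1

/-- The number operator `T† T`. -/
noncomputable def numOf (T : Module.End ℂ (Fock M)) : Module.End ℂ (Fock M) := dag T * T

end Fock

section Diagonal

variable {M : Type*} [Fintype M] [DecidableEq M]

theorem annih_single (m : M) (T : Finset M) :
    annih m (EuclideanSpace.single T (1 : ℂ)) =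
      if m ∈ T then jwSign m (T.erase m) • EuclideanSpace.single (T.erase m) (1 : ℂ) else 0 := by
  ext S
  by_cases hT : m ∈ T
  · by_cases hS : m ∈ S
    · have : S ≠ T.erase m := by
        rintro rfl
        simp at hS
      simp [annih, hT, hS, this]
    · by_cases hi : insert m S = T
      · subst hi
        simp [annih, hS]
      · have : S ≠ T.erase m := by
          rintro rfl
          exact hi (Finset.insert_erase hT)
        simp [annih, hT, hS, this, hi]
  · have : insert m S ≠ T := by
      rintro rfl
      simp at hT
    simp [annih, hT, this]

theorem jwSign_mul_conj (m : M) (S : Finset M) :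
    (starRingEnd ℂ) (jwSign m S) * jwSign m S = 1 := by
  simp [jwSign, ← mul_pow]

/-- Number operators of modes act diagonally on configurations. -/
theorem numOf_annih_apply (m : M) (ψ : Fock M) (S : Finset M) :
    numOf (annih m) ψ S = if m ∈ S then ψ S else 0 := by
  have h2 : inner ℂ (EuclideanSpace.single S (1 : ℂ)) (numOf (annih m) ψ) =
      numOf (annih m) ψ S := by
    rw [EuclideanSpace.inner_single_left, map_one, one_mul]
  have h3 : numOf (annih m) ψ = LinearMap.adjoint (annih m) (annih m ψ) := rfl
  rw [← h2, h3, LinearMap.adjoint_inner_right, annih_single]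
  by_cases h : m ∈ S
  · rw [if_pos h, if_pos h, inner_smul_left, EuclideanSpace.inner_single_left]
    simp only [annih, LinearMap.coe_mk, AddHom.coe_mk, Finset.notMem_erase, if_false,
      Finset.insert_erase h, map_one, one_mul]
    rw [← mul_assoc, jwSign_mul_conj, one_mul]
  · rw [if_neg h, if_neg h, inner_zero_left]

theorem commute_numOf_annih (m k : M) : Commute (numOf (annih m)) (numOf (annih k)) := by
  refine LinearMap.ext fun ψ => ?_
  ext S
  simp only [Module.End.mul_apply, numOf_annih_apply]
  split_ifs <;> rfl

end Diagonal

/-! ### The decorated square lattice with periodic boundary conditions -/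

/-- The sites of the `L × L` square lattice with periodic boundary conditions (Cu-sites). -/
abbrev DSite (L : ℕ) : Type := Fin 2 → ZMod L

/-- The mid-points of the nearest-neighbour bonds (O-sites): `(x, l)` is the site `x + δ_l / 2`. -/
abbrev PSite (L : ℕ) : Type := DSite L × Fin 2

/-- All sites of the decorated lattice. -/
abbrev Site (L : ℕ) : Type := DSite L ⊕ PSite L

/-- The two spin values, `true` for up and `false` for down; the opposite of `σ` is `!σ`. -/
abbrev Spin : Type := Bool

/-- The single-electron modes. -/
abbrev Mode (L : ℕ) : Type := Site L × Spin

/-- The unit vector along the axis `l`. -/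
def δ (L : ℕ) (l : Fin 2) : DSite L := Pi.single l 1

section Model

variable {L : ℕ}

/-- The end-points `D_u` of the bond with mid-point `u`: the D-sites at distance `1/2` from `u`. -/
def endpoints (u : PSite L) : Finset (DSite L) := {u.1, u.1 + δ L u.2}

variable [NeZero L]

/-- The set `P_x` of the P-sites at distance `1/2` from the D-site `x`. -/
def nbrs (x : DSite L) : Finset (PSite L) := Finset.univ.filter fun u => x ∈ endpoints u

/-- The `j`-th coordinate of the P-site `u = x + δ_l / 2`, for the representative of `x` with
coordinates in `{0, …, L - 1}`. -/
noncomputable def coord (u : PSite L) (j : Fin 2) : ℝ :=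
  ((u.1 j).val : ℝ) + if u.2 = j then 1 / 2 else 0

/-- The wave vector `Q = (0, π)`. -/
noncomputable def Q : Fin 2 → ℝ := ![0, Real.pi]

/-- The scalar product `Q · u`. The factors `exp (± 2 i Q · u)` do not depend on the
representatives modulo `L` of the coordinates of `u`. -/
noncomputable def Qdot (u : PSite L) : ℝ := ∑ j, Q j * coord u j

/-- The state space of electrons on the decorated lattice. -/
abbrev Fk (L : ℕ) [NeZero L] : Type := Fock (Mode L)

/-- The operators on the state space. -/
abbrev Op (L : ℕ) [NeZero L] : Type := Module.End ℂ (Fk L)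

/-- The annihilation operator `c_{i,σ}`. -/
noncomputable def c (i : Site L) (σ : Spin) : Op L := annih (i, σ)

/-- The number operator `n_{i,σ} = c_{i,σ}† c_{i,σ}`. -/
noncomputable def n (i : Site L) (σ : Spin) : Op L := numOf (c i σ)

/-- `a_{u,σ} = c_{u,σ} + α ∑_{x ∈ D_u} c_{x,σ}`. -/
noncomputable def a (α : ℝ) (u : PSite L) (σ : Spin) : Op L :=
  c (.inr u) σ + (α : ℂ) • ∑ x ∈ endpoints u, c (.inl x) σ

/-- `b_{x,σ} = c_{x,σ} + β ∑_{u ∈ P_x} c_{u,σ}`. -/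
noncomputable def b (β : ℝ) (x : DSite L) (σ : Spin) : Op L :=
  c (.inl x) σ + (β : ℂ) • ∑ u ∈ nbrs x, c (.inr u) σ

/-- `d_{x,σ} = ∑_{u ∈ P_x} exp (-2 i Q · u) a_{u,σ}`. -/
noncomputable def d (α : ℝ) (x : DSite L) (σ : Spin) : Op L :=
  ∑ u ∈ nbrs x, Complex.exp (-2 * Complex.I * (Qdot u : ℂ)) • a α u σ

/-- `𝒫_x = 1 - n_{x,↑} n_{x,↓}`. -/
noncomputable def projSite (x : DSite L) : Op L :=
  1 - n (.inl x) true * n (.inl x) false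

theorem commute_projSite (x y : DSite L) : Commute (projSite x) (projSite y) := by
  have h : ∀ (σ τ : Spin), Commute (n (Sum.inl x : Site L) σ) (n (Sum.inl y : Site L) τ) :=
    fun σ τ => commute_numOf_annih _ _
  have h2 : Commute (n (Sum.inl x : Site L) true * n (Sum.inl x : Site L) false)
      (n (Sum.inl y : Site L) true * n (Sum.inl y : Site L) false) :=
    ((h _ _).mul_right (h _ _)).mul_left ((h _ _).mul_right (h _ _))
  exact ((Commute.one_left _).sub_left ((Commute.one_right _).sub_right h2))

variable (L) in
/-- `𝒫_D = ∏_{x ∈ D} 𝒫_x`, the projection that eliminates doubly occupied D-sites. -/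
noncomputable def projD : Op L :=
  Finset.univ.noncommProd (fun x : DSite L => projSite x) fun x _ y _ _ => commute_projSite x y

/-- The product of `f i` over the elements `i` of `s`, taken in some order. -/
noncomputable def prodOver {ι : Type} (s : Finset ι) (f : ι → Op L) : Op L :=
  (s.toList.map f).prod

/-- The state `(∏_{x ∈ A} c†_{x,σ_x}) (∏_{u ∈ B↑} c†_{u,↑}) (∏_{u ∈ B↓} c†_{u,↓}) Φ₀`. -/
noncomputable def basisState (A : Finset (DSite L)) (σ : DSite L → Spin)
    (Bup Bdn : Finset (PSite L)) : Fk L :=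
  (prodOver A (fun x => dag (c (.inl x) (σ x))) *
    prodOver Bup (fun u => dag (c (.inr u) true)) *
    prodOver Bdn (fun u => dag (c (.inr u) false))) vacuum

variable (L) in
/-- The Hilbert space of `N` electrons without doubly occupied D-sites. -/
noncomputable def hilbert (N : ℕ) : Submodule ℂ (Fk L) :=
  Submodule.span ℂ {Ψ | ∃ (A : Finset (DSite L)) (σ : DSite L → Spin) (Bup Bdn : Finset (PSite L)),
    A.card + Bup.card + Bdn.card = N ∧ Ψ = basisState A σ Bup Bdn}

/-- The parameters of the model. -/
structure Params where
  (α β t s V₁ W₁ V₂ W₂ : ℝ)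

variable (L) in
/-- The hopping Hamiltonian `H₀`. -/
noncomputable def H0 (p : Params) : Op L :=
  projD L *
    ((p.t : ℂ) • ∑ x : DSite L, ∑ σ : Spin, numOf (b p.β x σ)
      + (p.s : ℂ) • ∑ u : PSite L, ∑ σ : Spin, n (.inr u) σ)
  * projD L

variable (L) in
/-- The first interaction Hamiltonian. -/
noncomputable def Hint1 (p : Params) : Op L :=
  projD L *
    (-((p.V₁ : ℂ) • ∑ x : DSite L, ∑ σ : Spin, numOf (d p.α x (!σ)) * numOf (b p.β x σ))
      - (p.W₁ : ℂ) • ∑ x : DSite L, ∑ l : Fin 2, ∑ σ : Spin,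
          (n (.inl (x + δ L l)) σ + n (.inl (x - δ L l)) σ) * numOf (b p.β x σ))
  * projD L

variable (L) in
/-- The second interaction Hamiltonian. -/
noncomputable def Hint2 (p : Params) : Op L :=
  projD L *
    (-((p.V₂ : ℂ) • ∑ u : PSite L, ∑ σ : Spin, numOf (a p.α u (!σ)) * n (.inr u) σ)
      - (p.W₂ : ℂ) • ∑ u : PSite L, ∑ x ∈ endpoints u, ∑ σ : Spin,
          n (.inl x) σ * n (.inr u) σ)
  * projD L

variable (L) in
/-- The Hamiltonian of the model. -/
noncomputable def H (p : Params) : Op L := H0 L p + Hint1 L p + Hint2 L p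

variable (L) in
/-- The pair creation operator `ζ† = ∑_{u ∈ P} exp (2 i Q · u) a†_{u,↑} a†_{u,↓}`. -/
noncomputable def zetaDag (α : ℝ) : Op L :=
  ∑ u : PSite L, Complex.exp (2 * Complex.I * (Qdot u : ℂ)) • (dag (a α u true) * dag (a α u false))

variable (L) in
/-- `E` is the ground-state energy of `H` for `N` electrons: its lowest eigenvalue on the
`N`-electron Hilbert space. -/
def IsGroundEnergy (p : Params) (N : ℕ) (E : ℝ) : Prop :=
  IsLeast {E : ℝ | ∃ Φ ∈ hilbert L N, Φ ≠ 0 ∧ H L p Φ = (E : ℂ) • Φ} E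

/-- `Φ` is a ground state of `H` for `N` electrons: a nonzero `N`-electron eigenstate whose
eigenvalue is the ground-state energy. -/
def IsGroundState (p : Params) (N : ℕ) (Φ : Fk L) : Prop :=
  Φ ∈ hilbert L N ∧ Φ ≠ 0 ∧ ∃ E : ℝ, IsGroundEnergy L p N E ∧ H L p Φ = (E : ℂ) • Φ

end Model

end CuO2

/-!
# Pair-condensed ground states of the decorated square lattice

Put `𝒫 = projD L`. The parameters are tuned so that the Hamiltonian is a sum of squares: the
anticommutator of a superposition of annihilation operators with its adjoint is a number, up to a
correction under `𝒫` for the D-sites at which the creation of an electron is blocked by an electron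
of the opposite spin (`projD_lin_star_lin`). The terms with `W₁` and `W₂` are precisely these
corrections, and `H_eq_sum` reads `H = V₁ ∑ K†K + V₂ ∑ K'†K'` with `K = 𝒫 d†_{x,-σ} b_{x,σ} 𝒫` and
`K' = 𝒫 a†_{u,-σ} c_{u,σ} 𝒫`. So no eigenvalue is negative, and the zero-energy states are the
common kernel of all `K` and `K'`.

The powers of `ζ†` are in this kernel, because the commutator of `c_{u,σ}` with `ζ†` is a multiple
of `a†_{u,-σ}`, that of `c_{x,σ}` and of `∑_{u ∈ P_x} c_{u,σ}` is a multiple of `d†_{x,-σ}`, and the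
squares of these creation operators vanish (`mul_pow_vacuum_eq_zero`). The phases enter through the
fact that the orbital `d_x` has no weight on the site `x` itself.

For uniqueness, let `W` be the exponential of `α ∑ c†_x c_u`, summed over the neighbouring pairs
`x, u` and the spins (`dress`). It satisfies `a†_u W = W c†_u`, `c_u W = W c_u`,
`c_x W = W (c_x + α ∑_{u ∈ P_x} c_u)` and `𝒫 W 𝒫 = 𝒫 W`, so every `Ψ` in the range of `𝒫` is `𝒫 W χ`
for exactly one `χ` in that range. In terms of `χ` the equations for a zero-energy state become
elementary (`IsReduced`): the equations of the P-sites say that each P-site is empty or doubly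
occupied (`IsReduced.paired`), and those of the D-sites say that all four bonds at an occupied
D-site are full (`IsReduced.mem_of_occupied`) and, as `α + β ≠ 0`, that the amplitudes of two
configurations that differ by moving one pair between two bonds at an empty D-site vanish together
(`IsReduced.movePair_ne_zero`). The bonds form a connected graph, so an empty P-site could be moved
next to any occupied D-site; as there are at most `2 |P|` electrons, all D-sites are empty. The
pairs can be moved to any other positions, so a nonzero `χ` has nonzero amplitude on every
configuration of pairs with the right number of electrons
(`IsReduced.even_and_pairConfig_ne_zero`). Hence the number of electrons is even, and two
zero-energy states are proportional, since a suitable combination of them has a vanishing amplitude.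

The pair state is nonzero since the undressed pair creation operator is the raising operator of a
pseudospin `|P| / 2` (`star_pairDag_pairDag_pow_vacuum`). For odd electron numbers the lowest
eigenvalue exists, as the Hamiltonian is symmetric on a nonzero finite-dimensional space; it is
nonnegative and not zero.
-/

namespace CuO2

/-! ### Canonical anticommutation relations, diagonal projections and particle number -/

section FockSpace

variable {M : Type*} [Fintype M] [DecidableEq M]

theorem inner_star_left (T : Module.End ℂ (Fock M)) (ψ φ : Fock M) :
    inner ℂ (star T ψ) φ = inner ℂ ψ (T φ) := LinearMap.adjoint_inner_left T φ ψ

theorem star_apply (T : Module.End ℂ (Fock M)) (ψ : Fock M) (S : Finset M) :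
    star T ψ S = inner ℂ (T (EuclideanSpace.single S (1 : ℂ))) ψ := by
  have h : inner ℂ (EuclideanSpace.single S (1 : ℂ)) (star T ψ) = star T ψ S := by
    rw [EuclideanSpace.inner_single_left, map_one, one_mul]
  rw [← h]
  exact LinearMap.adjoint_inner_right T _ _

theorem annih_apply (m : M) (ψ : Fock M) (S : Finset M) :
    annih m ψ S = if m ∈ S then 0 else jwSign m S * ψ (insert m S) := rfl

omit [DecidableEq M] in
theorem star_jwSign (m : M) (S : Finset M) : (starRingEnd ℂ) (jwSign m S) = jwSign m S := by
  simp [jwSign]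

theorem jwSign_mul_self (m : M) (S : Finset M) : jwSign m S * jwSign m S = 1 := by
  have := jwSign_mul_conj m S
  rwa [star_jwSign] at this

theorem jwSign_ne_zero (m : M) (S : Finset M) : jwSign m S ≠ 0 :=
  left_ne_zero_of_mul_eq_one (jwSign_mul_self m S)

theorem star_annih_apply (m : M) (ψ : Fock M) (S : Finset M) :
    star (annih m) ψ S = if m ∈ S then jwSign m (S.erase m) * ψ (S.erase m) else 0 := by
  rw [star_apply, annih_single]
  split_ifs
  · rw [inner_smul_left, EuclideanSpace.inner_single_left, star_jwSign, map_one, one_mul]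
  · exact inner_zero_left _

theorem jwSign_insert (m : M) {k : M} {S : Finset M} (h : k ∉ S) :
    jwSign m (insert k S) =
      (if Fintype.equivFin M k < Fintype.equivFin M m then -1 else 1) * jwSign m S := by
  unfold jwSign
  rw [Finset.filter_insert]
  split_ifs with h1
  · rw [Finset.card_insert_of_notMem (by simp [h]), pow_succ]
    ring
  · rw [one_mul]

omit [DecidableEq M] in
/-- The sign picked up when two distinct modes are exchanged. -/
theorem jwSign_swap {m k : M} (hmk : m ≠ k) :
    (if Fintype.equivFin M k < Fintype.equivFin M m then (-1 : ℂ) else 1) =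
      -(if Fintype.equivFin M m < Fintype.equivFin M k then -1 else 1) := by
  rcases lt_trichotomy (Fintype.equivFin M k) (Fintype.equivFin M m) with h | h | h
  · simp [h, h.not_gt]
  · exact absurd ((Fintype.equivFin M).injective h).symm hmk
  · simp [h, h.not_gt]

theorem annih_mul_annih (m k : M) : annih m * annih k = -(annih k * annih m) := by
  refine LinearMap.ext fun ψ => ?_
  ext S
  rcases eq_or_ne m k with rfl | hmk
  · simp [annih_apply]
  · by_cases hm : m ∈ S
    · simp [annih_apply, hm]
    by_cases hk : k ∈ S
    · simp [annih_apply, hk]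
    simp only [Module.End.mul_apply, LinearMap.neg_apply, PiLp.neg_apply, annih_apply,
      Finset.mem_insert, hm, hk, hmk, hmk.symm, or_false, if_false]
    rw [jwSign_insert k hm, jwSign_insert m hk, jwSign_swap hmk, Finset.insert_comm]
    ring

theorem annih_mul_star_annih (m k : M) :
    annih m * star (annih k) = (if m = k then 1 else 0) - star (annih k) * annih m := by
  refine LinearMap.ext fun ψ => ?_
  ext S
  rcases eq_or_ne m k with rfl | hmk
  · by_cases hm : m ∈ S
    · simp [annih_apply, star_annih_apply, hm, ← mul_assoc, jwSign_mul_self]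
    · simp [annih_apply, star_annih_apply, hm, ← mul_assoc, jwSign_mul_self]
  · by_cases hm : m ∈ S
    · simp [annih_apply, star_annih_apply, hm, hmk]
    by_cases hk : k ∈ S
    · obtain ⟨R, hR, rfl⟩ : ∃ R, k ∉ R ∧ S = insert k R :=
        ⟨S.erase k, by simp, (Finset.insert_erase hk).symm⟩
      have hmR : m ∉ R := fun h => hm (Finset.mem_insert_of_mem h)
      have e : (insert m (insert k R)).erase k = insert m R := by
        rw [Finset.insert_comm, Finset.erase_insert]
        simp [hR, hmk.symm]
      simp only [Module.End.mul_apply, LinearMap.sub_apply, PiLp.sub_apply, annih_apply,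
        star_annih_apply, Finset.mem_insert, hmk, hmR, hR, hmk.symm, or_false, if_false,
        if_true, or_true, Finset.erase_insert hR, e, LinearMap.zero_apply,
        PiLp.zero_apply]
      rw [jwSign_insert k hmR, jwSign_insert m hR, jwSign_swap hmk]
      split_ifs <;> ring
    · simp [annih_apply, star_annih_apply, hk, hmk, hmk.symm]

theorem star_annih_mul_star_annih (m k : M) :
    star (annih m) * star (annih k) = -(star (annih k) * star (annih m)) := by
  rw [← star_mul, annih_mul_annih, star_neg, star_mul]

theorem annih_vacuum (m : M) : annih m vacuum = 0 := by
  rw [vacuum, annih_single]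
  simp

/-- The orthogonal projection onto the span of the configurations satisfying `p`. -/
noncomputable def proj (p : Finset M → Prop) : Module.End ℂ (Fock M) where
  toFun ψ := open Classical in WithLp.toLp 2 fun S => if p S then ψ S else 0
  map_add' ψ φ := by
    ext S
    by_cases h : p S <;> simp [h]
  map_smul' z ψ := by
    ext S
    by_cases h : p S <;> simp [h]

open Classical in
theorem proj_apply (p : Finset M → Prop) (ψ : Fock M) (S : Finset M) :
    proj p ψ S = if p S then ψ S else 0 := rfl

theorem proj_mul_proj (p q : Finset M → Prop) : proj p * proj q = proj fun S => p S ∧ q S := by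
  refine LinearMap.ext fun ψ => ?_
  ext S
  by_cases h : p S <;> by_cases h' : q S <;> simp [proj_apply, h, h']

theorem proj_mul_self (p : Finset M → Prop) : proj p * proj p = proj p := by
  rw [proj_mul_proj]
  simp

open Classical in
theorem star_proj (p : Finset M → Prop) : star (proj p) = proj p := by
  refine LinearMap.ext fun ψ => ?_
  ext S
  rw [star_apply]
  have : proj p (EuclideanSpace.single S (1 : ℂ)) =
      if p S then EuclideanSpace.single S (1 : ℂ) else 0 := by
    ext T
    by_cases hS : p S
    · by_cases h : T = S
      · subst h; simp [proj_apply, hS]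
      · simp [proj_apply, h, hS]
    · by_cases h : T = S
      · subst h; simp [proj_apply, hS]
      · simp [proj_apply, hS, h]
  rw [this, proj_apply]
  split_ifs
  · rw [EuclideanSpace.inner_single_left, map_one, one_mul]
  · exact inner_zero_left _

theorem proj_eq_self_iff {p : Finset M → Prop} {ψ : Fock M} :
    proj p ψ = ψ ↔ ∀ S, ψ S ≠ 0 → p S := by
  constructor
  · intro h S hS
    by_contra hp
    rw [← h, proj_apply, if_neg hp] at hS
    exact hS rfl
  · intro h
    ext S
    rw [proj_apply]
    split_ifs with hp
    · rfl
    · by_contra h0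
      exact hp (h S (Ne.symm h0))

/-- `T` maps the kernel of the projection `R` into itself, so that `R` may be inserted to the right
of `T` when it stands to the left. -/
def Lowers (R T : Module.End ℂ (Fock M)) : Prop := R * T * R = R * T

theorem Lowers.add {R T U : Module.End ℂ (Fock M)} (hT : Lowers R T) (hU : Lowers R U) :
    Lowers R (T + U) := by
  unfold Lowers at *
  rw [mul_add, add_mul, hT, hU]

theorem Lowers.smul {R T : Module.End ℂ (Fock M)} (z : ℂ) (hT : Lowers R T) :
    Lowers R (z • T) := by
  unfold Lowers at *
  rw [mul_smul_comm, smul_mul_assoc, hT]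

theorem Lowers.mul {R T U : Module.End ℂ (Fock M)} (hT : Lowers R T) (hU : Lowers R U) :
    Lowers R (T * U) := by
  unfold Lowers at *
  rw [← mul_assoc, ← hT, mul_assoc (R * T) R U, mul_assoc (R * T), hU]

theorem Lowers.sum {ι : Type*} {R : Module.End ℂ (Fock M)} {s : Finset ι}
    {T : ι → Module.End ℂ (Fock M)} (h : ∀ i ∈ s, Lowers R (T i)) : Lowers R (∑ i ∈ s, T i) := by
  unfold Lowers at *
  rw [Finset.mul_sum, Finset.sum_mul]
  exact Finset.sum_congr rfl h

theorem lowers_of_commute {R T : Module.End ℂ (Fock M)} (hR : R * R = R) (h : Commute R T) :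
    Lowers R T := by
  unfold Lowers
  rw [mul_assoc, ← h.eq, ← mul_assoc, hR]

/-- Creating a particle cannot restore a condition that is inherited by smaller configurations. -/
theorem lowers_star_annih {p : Finset M → Prop} (hp : ∀ S m, p S → p (S.erase m)) (m : M) :
    Lowers (proj p) (star (annih m)) := by
  refine LinearMap.ext fun ψ => ?_
  ext S
  simp only [Module.End.mul_apply, proj_apply, star_annih_apply]
  split_ifs with h1 h2 h3
  · rfl
  · exact absurd (hp S m h1) h3
  · rfl
  · rfl

theorem commute_proj_annih {p : Finset M → Prop} {m : M} (hp : ∀ S, p (insert m S) ↔ p S) :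
    Commute (proj p) (annih m) := by
  refine LinearMap.ext fun ψ => ?_
  ext S
  have := hp S
  by_cases h : p S <;> by_cases hm : m ∈ S <;>
    simp_all [proj_apply, annih_apply]

theorem commute_star_of_commute {R T : Module.End ℂ (Fock M)} (hR : star R = R)
    (h : Commute R T) : Commute R (star T) := by
  have := congrArg star h.eq
  rw [star_mul, star_mul, hR] at this
  exact this.symm

theorem proj_vacuum {p : Finset M → Prop} (hp : p ∅) : proj p vacuum = vacuum := by
  rw [proj_eq_self_iff]
  intro S hS
  have : S = ∅ := by
    by_contra h
    simp [vacuum, h] at hS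
  rwa [this]

/-- A product of creation operators of distinct modes, applied to the vacuum, is a configuration
up to a nonzero factor. -/
theorem prod_star_annih_vacuum (l : List M) (hl : l.Nodup) :
    ∃ z : ℂ, z ≠ 0 ∧ (l.map fun m => star (annih m)).prod vacuum =
      z • EuclideanSpace.single l.toFinset (1 : ℂ) := by
  induction l with
  | nil => exact ⟨1, one_ne_zero, by simp [vacuum]⟩
  | cons m l ih =>
    obtain ⟨z, hz, h⟩ := ih hl.of_cons
    have hm : m ∉ l.toFinset := by simpa using hl.notMem
    refine ⟨jwSign m l.toFinset * z, mul_ne_zero (jwSign_ne_zero _ _) hz, ?_⟩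
    rw [List.map_cons, List.prod_cons, Module.End.mul_apply, h, List.toFinset_cons]
    ext S
    rw [map_smul, PiLp.smul_apply, star_annih_apply]
    by_cases hS : m ∈ S
    · by_cases he : S = insert m l.toFinset
      · subst he
        simp [Finset.erase_insert hm, mul_comm]
      · have : S.erase m ≠ l.toFinset := by
          intro h'
          exact he (by rw [← h', Finset.insert_erase hS])
        simp [hS, he, this]
    · have : S ≠ insert m l.toFinset := by
        rintro rfl
        simp at hS
      simp [hS, this]

/-- The operator that multiplies each configuration by its number of particles. -/
noncomputable def totalNum (M : Type*) [Fintype M] [DecidableEq M] : Module.End ℂ (Fock M) where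
  toFun ψ := WithLp.toLp 2 fun S => (S.card : ℂ) * ψ S
  map_add' ψ φ := by
    ext S
    simp [mul_add]
  map_smul' z ψ := by
    ext S
    simp [mul_left_comm]

theorem totalNum_apply (ψ : Fock M) (S : Finset M) :
    totalNum M ψ S = (S.card : ℂ) * ψ S := rfl

/-- `T` changes the number of particles by `k`. -/
def HasCharge (k : ℤ) (T : Module.End ℂ (Fock M)) : Prop :=
  totalNum M * T = T * totalNum M + (k : ℂ) • T

theorem HasCharge.add {k : ℤ} {T U : Module.End ℂ (Fock M)} (hT : HasCharge k T)
    (hU : HasCharge k U) : HasCharge k (T + U) := by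
  unfold HasCharge at *
  rw [mul_add, add_mul, hT, hU, smul_add]
  abel

theorem HasCharge.smul {k : ℤ} {T : Module.End ℂ (Fock M)} (z : ℂ) (hT : HasCharge k T) :
    HasCharge k (z • T) := by
  unfold HasCharge at *
  rw [mul_smul_comm, smul_mul_assoc, hT, smul_add, smul_comm]

theorem HasCharge.sum {k : ℤ} {ι : Type*} {s : Finset ι} {T : ι → Module.End ℂ (Fock M)}
    (h : ∀ i ∈ s, HasCharge k (T i)) : HasCharge k (∑ i ∈ s, T i) := by
  unfold HasCharge at *
  rw [Finset.mul_sum, Finset.sum_mul, Finset.smul_sum, ← Finset.sum_add_distrib]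
  exact Finset.sum_congr rfl h

theorem HasCharge.mul {k j : ℤ} {T U : Module.End ℂ (Fock M)} (hT : HasCharge k T)
    (hU : HasCharge j U) : HasCharge (k + j) (T * U) := by
  unfold HasCharge at *
  rw [← mul_assoc, hT, add_mul, mul_assoc T, hU, mul_add, smul_mul_assoc, mul_smul_comm,
    ← mul_assoc, Int.cast_add, add_smul]
  abel

theorem star_totalNum : star (totalNum M) = totalNum M := by
  refine LinearMap.ext fun ψ => ?_
  ext S
  rw [star_apply, totalNum_apply]
  have : totalNum M (EuclideanSpace.single S (1 : ℂ)) =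
      (S.card : ℂ) • EuclideanSpace.single S (1 : ℂ) := by
    ext T
    rw [totalNum_apply, PiLp.smul_apply]
    by_cases h : T = S
    · subst h; simp
    · simp [h]
  rw [this, inner_smul_left, EuclideanSpace.inner_single_left, map_one, one_mul]
  simp

theorem HasCharge.star {k : ℤ} {T : Module.End ℂ (Fock M)} (hT : HasCharge k T) :
    HasCharge (-k) (star T) := by
  unfold HasCharge at *
  have := congrArg Star.star hT
  rw [star_mul, star_add, star_mul, star_smul, star_totalNum] at this
  rw [this]
  simp

theorem hasCharge_annih (m : M) : HasCharge (-1) (annih m) := by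
  refine LinearMap.ext fun ψ => ?_
  ext S
  by_cases h : m ∈ S
  · simp [annih_apply, totalNum_apply, h]
  · simp [annih_apply, totalNum_apply, h]
    ring

theorem hasCharge_proj (p : Finset M → Prop) : HasCharge 0 (proj p) := by
  refine LinearMap.ext fun ψ => ?_
  ext S
  by_cases h : p S <;> simp [proj_apply, totalNum_apply, h]

theorem hasCharge_one : HasCharge 0 (1 : Module.End ℂ (Fock M)) := by
  simp [HasCharge]

theorem HasCharge.pow {k : ℤ} {T : Module.End ℂ (Fock M)} (hT : HasCharge k T) (r : ℕ) :
    HasCharge (r * k) (T ^ r) := by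
  induction r with
  | zero => simpa using hasCharge_one
  | succ r ih =>
    have := ih.mul hT
    rw [pow_succ]
    convert this using 1
    push_cast
    ring

theorem totalNum_vacuum : totalNum M vacuum = 0 := by
  ext S
  rw [totalNum_apply]
  by_cases h : S = ∅
  · simp [h]
  · simp [vacuum, h]

theorem HasCharge.apply {k : ℤ} {T : Module.End ℂ (Fock M)} (hT : HasCharge k T) {ψ : Fock M}
    {z : ℂ} (hψ : totalNum M ψ = z • ψ) : totalNum M (T ψ) = (z + k) • T ψ := by
  have := LinearMap.congr_fun hT ψ
  simp only [Module.End.mul_apply, LinearMap.add_apply, LinearMap.smul_apply, hψ, map_smul] at this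
  rw [this, add_smul]

theorem totalNum_eq_iff {ψ : Fock M} {N : ℕ} :
    totalNum M ψ = (N : ℂ) • ψ ↔ ∀ S, ψ S ≠ 0 → S.card = N := by
  constructor
  · intro h S hS
    have := congrArg (fun φ : Fock M => φ S) h
    simp only [totalNum_apply, PiLp.smul_apply, smul_eq_mul] at this
    exact Nat.cast_injective (R := ℂ) (mul_right_cancel₀ hS this)
  · intro h
    ext S
    rw [totalNum_apply, PiLp.smul_apply, smul_eq_mul]
    by_cases hS : ψ S = 0
    · simp [hS]
    · rw [h S hS]

end FockSpace

/-! ### Orbitals and the projection onto states without double occupancy -/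

section Operators

variable {L : ℕ}

/-- No D-site is doubly occupied. -/
def NoDouble (S : Finset (Mode L)) : Prop :=
  ∀ x : DSite L, ¬(((.inl x, true) : Mode L) ∈ S ∧ ((.inl x, false) : Mode L) ∈ S)

theorem NoDouble.mono {S T : Finset (Mode L)} (h : NoDouble T) (hST : S ⊆ T) : NoDouble S :=
  fun x hx => h x ⟨hST hx.1, hST hx.2⟩

theorem NoDouble.notMem_flip {S : Finset (Mode L)} (h : NoDouble S) {x : DSite L} {σ : Spin}
    (hx : (.inl x, σ) ∈ S) : (.inl x, !σ) ∉ S := by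
  intro h'
  cases σ
  · exact h x ⟨h', hx⟩
  · exact h x ⟨hx, h'⟩

theorem noDouble_insert_inr (S : Finset (Mode L)) (u : PSite L) (σ : Spin) :
    NoDouble (insert (.inr u, σ) S) ↔ NoDouble S := by
  simp [NoDouble]

theorem noDouble_insert_inl {S : Finset (Mode L)} {x : DSite L} {σ : Spin}
    (h : (.inl x, !σ) ∉ S) : NoDouble (insert (.inl x, σ) S) ↔ NoDouble S := by
  constructor
  · exact fun h' => h'.mono (Finset.subset_insert _ _)
  · intro h' y hy
    have := h' y
    cases σ <;> simp at h hy <;> grind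

theorem not_noDouble_insert_inl {S : Finset (Mode L)} {x : DSite L} {σ : Spin}
    (h : (.inl x, !σ) ∈ S) : ¬NoDouble (insert (.inl x, σ) S) := fun h' =>
  h'.notMem_flip (Finset.mem_insert_self _ _) (Finset.mem_insert_of_mem h)

variable [NeZero L]

theorem n_apply (i : Site L) (σ : Spin) (ψ : Fk L) (S : Finset (Mode L)) :
    n i σ ψ S = if (i, σ) ∈ S then ψ S else 0 := numOf_annih_apply _ _ _

theorem projSite_eq (x : DSite L) :
    projSite x = proj fun S : Finset (Mode L) =>
      ¬(((.inl x, true) : Mode L) ∈ S ∧ ((.inl x, false) : Mode L) ∈ S) := by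
  refine LinearMap.ext fun ψ => ?_
  ext S
  by_cases h : ((.inl x, true) : Mode L) ∈ S <;> by_cases h' : ((.inl x, false) : Mode L) ∈ S <;>
    simp [projSite, proj_apply, n_apply, h, h']

theorem projD_eq : projD L = proj NoDouble := by
  have key : ∀ (s : Finset (DSite L))
      (h : (s : Set (DSite L)).Pairwise (Function.onFun Commute fun x => projSite x)),
      s.noncommProd (fun x : DSite L => projSite x) h =
        proj fun S : Finset (Mode L) => ∀ x ∈ s,
          ¬(((.inl x, true) : Mode L) ∈ S ∧ ((.inl x, false) : Mode L) ∈ S) := by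
    intro s h
    induction s using Finset.induction_on with
    | empty =>
      rw [Finset.noncommProd_empty]
      refine LinearMap.ext fun ψ => ?_
      ext S
      simp [proj_apply]
    | insert x s hx ih =>
      rw [Finset.noncommProd_insert_of_notMem _ _ _ _ hx,
        ih (h.mono (by simp)), projSite_eq, proj_mul_proj]
      simp only [Finset.forall_mem_insert]
  refine (key Finset.univ _).trans ?_
  simp only [Finset.mem_univ, true_implies]
  rfl

theorem star_projD : star (projD L) = projD L := by rw [projD_eq, star_proj]

theorem projD_mul_self : projD L * projD L = projD L := by rw [projD_eq, proj_mul_self]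

/-- The annihilation operator `∑ i, g i • c_{i,σ}` of a superposition of sites. -/
noncomputable def lin (g : Site L → ℂ) (σ : Spin) : Op L := ∑ i, g i • c i σ

theorem c_eq_lin (i : Site L) (σ : Spin) : c i σ = lin (Pi.single i 1) σ := by
  simp [lin, Pi.single_apply, ite_smul]

theorem star_lin (g : Site L → ℂ) (σ : Spin) :
    star (lin g σ) = ∑ i, star (g i) • star (c i σ) := by
  simp [lin, star_sum, star_smul]

theorem c_mul_c (i j : Site L) (σ τ : Spin) : c i σ * c j τ = -(c j τ * c i σ) :=
  annih_mul_annih _ _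

theorem c_mul_star_c (i j : Site L) (σ τ : Spin) :
    c i σ * star (c j τ) = (if (i, σ) = (j, τ) then 1 else 0) - star (c j τ) * c i σ :=
  annih_mul_star_annih _ _

theorem lin_mul_lin (g h : Site L → ℂ) (σ τ : Spin) :
    lin g σ * lin h τ = -(lin h τ * lin g σ) := by
  simp only [lin, Finset.sum_mul_sum, ← Finset.sum_neg_distrib]
  rw [Finset.sum_comm]
  refine Finset.sum_congr rfl fun j _ => Finset.sum_congr rfl fun i _ => ?_
  rw [smul_mul_smul_comm, c_mul_c, smul_mul_smul_comm, smul_neg, mul_comm]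

theorem star_lin_mul_star_lin (g h : Site L → ℂ) (σ τ : Spin) :
    star (lin g σ) * star (lin h τ) = -(star (lin h τ) * star (lin g σ)) := by
  rw [← star_mul, lin_mul_lin, star_neg, star_mul]

theorem star_lin_mul_self (g : Site L → ℂ) (σ : Spin) : star (lin g σ) * star (lin g σ) = 0 := by
  have h : (2 : ℂ) • (star (lin g σ) * star (lin g σ)) = 0 := by
    rw [two_smul]
    nth_rewrite 1 [star_lin_mul_star_lin]
    exact neg_add_cancel _
  exact (smul_eq_zero.mp h).resolve_left two_ne_zero

theorem lin_mul_star_lin (g h : Site L → ℂ) (σ : Spin) :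
    lin g σ * star (lin h σ) =
      (∑ i, g i * star (h i)) • (1 : Op L) - star (lin h σ) * lin g σ := by
  rw [star_lin, lin, Finset.sum_mul_sum, Finset.sum_mul_sum, Finset.sum_comm, Finset.sum_smul,
    ← Finset.sum_sub_distrib]
  refine Finset.sum_congr rfl fun j _ => ?_
  have : ∀ i, (g i • c i σ) * (star (h j) • star (c j σ)) =
      (if i = j then (g j * star (h j)) • (1 : Op L) else 0) -
        (star (h j) • star (c j σ)) * (g i • c i σ) := by
    intro i
    rw [smul_mul_smul_comm, c_mul_star_c, smul_mul_smul_comm, smul_sub, mul_comm (star (h j))]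
    by_cases hij : i = j <;> simp [hij]
  rw [Finset.sum_congr rfl fun i _ => this i, Finset.sum_sub_distrib]
  simp

theorem lin_mul_star_lin_of_ne (g h : Site L → ℂ) {σ τ : Spin} (hστ : σ ≠ τ) :
    lin g σ * star (lin h τ) = -(star (lin h τ) * lin g σ) := by
  rw [star_lin, lin, Finset.sum_mul_sum, Finset.sum_mul_sum, Finset.sum_comm,
    ← Finset.sum_neg_distrib]
  refine Finset.sum_congr rfl fun j _ => ?_
  rw [← Finset.sum_neg_distrib]
  refine Finset.sum_congr rfl fun i _ => ?_
  rw [smul_mul_smul_comm, c_mul_star_c, smul_mul_smul_comm, mul_comm (star (h j))]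
  simp [hστ]

theorem star_lin_mul_lin_of_ne (g h : Site L → ℂ) {σ τ : Spin} (hστ : σ ≠ τ) :
    star (lin h τ) * lin g σ = -(lin g σ * star (lin h τ)) := by
  rw [lin_mul_star_lin_of_ne g h hστ, neg_neg]

theorem commute_mul_of_anticommute {R : Type*} [Ring R] {x y z : R} (hx : x * z = -(z * x))
    (hy : y * z = -(z * y)) : Commute (x * y) z := by
  show x * y * z = z * (x * y)
  rw [mul_assoc, hy, mul_neg, ← mul_assoc, hx, neg_mul, neg_neg, mul_assoc]

theorem numOf_eq (T : Op L) : numOf T = star T * T := rfl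

theorem star_numOf (T : Op L) : star (numOf T) = numOf T := by
  rw [numOf_eq, star_mul, star_star]

theorem commute_numOf_lin (g h : Site L → ℂ) {σ τ : Spin} (hστ : σ ≠ τ) :
    Commute (numOf (lin g σ)) (lin h τ) :=
  commute_mul_of_anticommute (star_lin_mul_lin_of_ne _ _ hστ.symm) (lin_mul_lin _ _ _ _)

theorem n_mul_lin (i : Site L) (g : Site L → ℂ) (σ : Spin) :
    n i σ * lin g σ = lin g σ * n i σ - g i • c i σ := by
  have h1 : star (c i σ) * lin g σ = g i • 1 - lin g σ * star (c i σ) := by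
    rw [c_eq_lin, lin_mul_star_lin]
    simp [Pi.single_apply, apply_ite]
  have h2 : c i σ * lin g σ = -(lin g σ * c i σ) := by
    rw [c_eq_lin, lin_mul_lin]
  rw [n, numOf_eq, mul_assoc, h2, mul_neg, ← mul_assoc, h1, sub_mul, smul_mul_assoc, one_mul,
    mul_assoc, neg_sub]

theorem commute_n_lin_of_ne (i : Site L) (g : Site L → ℂ) {σ τ : Spin} (hστ : σ ≠ τ) :
    Commute (n i σ) (lin g τ) := by
  rw [n, c_eq_lin]
  exact commute_numOf_lin _ _ hστ

theorem commute_n_lin (i : Site L) {g : Site L → ℂ} (hg : g i = 0) (σ τ : Spin) :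
    Commute (n i σ) (lin g τ) := by
  by_cases h : σ = τ
  · subst h
    rw [Commute, SemiconjBy, n_mul_lin, hg, zero_smul, sub_zero]
  · exact commute_n_lin_of_ne i g h

theorem lowers_projD_star_lin (g : Site L → ℂ) (σ : Spin) :
    Lowers (projD L) (star (lin g σ)) := by
  rw [star_lin, projD_eq]
  exact Lowers.sum fun i _ => Lowers.smul _
    (lowers_star_annih (fun S m hS => hS.mono (Finset.erase_subset _ _)) _)

theorem projD_mul_lin_mul_projD (g : Site L → ℂ) (σ : Spin) :
    projD L * lin g σ * projD L = lin g σ * projD L := by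
  have := congrArg star (lowers_projD_star_lin g σ)
  simpa only [star_mul, star_star, star_projD, ← mul_assoc] using this

theorem commute_projD_c_inr (u : PSite L) (σ : Spin) : Commute (projD L) (c (.inr u) σ) := by
  rw [projD_eq]
  exact commute_proj_annih fun S => noDouble_insert_inr S u σ

theorem commute_projD_n (i : Site L) (σ : Spin) : Commute (projD L) (n i σ) := by
  refine LinearMap.ext fun ψ => ?_
  ext S
  simp only [projD_eq, Module.End.mul_apply, proj_apply, n_apply]
  split_ifs <;> rfl

/-- Between the projections, creation at a D-site is blocked by an electron of the opposite spin. -/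
theorem projD_mul_star_c_inl_mul_projD (y : DSite L) (σ : Spin) :
    projD L * star (c (.inl y) σ) * projD L =
      (star (c (.inl y) σ) - star (c (.inl y) σ) * n (.inl y) (!σ)) * projD L := by
  refine LinearMap.ext fun ψ => ?_
  ext S
  by_cases hm : ((.inl y, σ) : Mode L) ∈ S
  · obtain ⟨R, hR, rfl⟩ : ∃ R, ((.inl y, σ) : Mode L) ∉ R ∧ S = insert (.inl y, σ) R :=
      ⟨S.erase (.inl y, σ), by simp, (Finset.insert_erase hm).symm⟩
    by_cases h : ((.inl y, !σ) : Mode L) ∈ R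
    · simp [projD_eq, sub_mul, mul_assoc, c, proj_apply, star_annih_apply, n_apply, hR, h,
        not_noDouble_insert_inl h]
    · simp [projD_eq, sub_mul, mul_assoc, c, proj_apply, star_annih_apply, n_apply, hR, h,
        noDouble_insert_inl h]
      exact fun h1 h2 => absurd h2 h1
  · simp [projD_eq, sub_mul, mul_assoc, c, proj_apply, star_annih_apply, hm]

theorem projD_mul_star_c_inl_mul_n (y : DSite L) (σ : Spin) :
    projD L * (star (c (.inl y) σ) * n (.inl y) (!σ)) = 0 := by
  refine LinearMap.ext fun ψ => ?_
  ext S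
  by_cases hm : ((.inl y, σ) : Mode L) ∈ S
  · by_cases h : ((.inl y, !σ) : Mode L) ∈ S
    · have : ¬NoDouble S := fun h' => h'.notMem_flip hm h
      simp [projD_eq, proj_apply, this]
    · simp [projD_eq, c, proj_apply, star_annih_apply, n_apply, h]
  · simp [projD_eq, c, proj_apply, star_annih_apply, hm]

/-- The anticommutation relation between the operators of a superposition of sites, restricted to
states without doubly occupied D-sites. The correction with respect to the relation without the
projections comes from the D-sites where the creation of an electron is blocked. -/
theorem projD_lin_star_lin (g : Site L → ℂ) (τ : Spin) :
    projD L * lin g τ * projD L * star (lin g τ) * projD L =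
      projD L * ((∑ i, g i * star (g i)) • 1 - numOf (lin g τ) -
        ∑ y : DSite L, (g (.inl y) * star (g (.inl y))) • n (.inl y) (!τ)) * projD L := by
  set f := lin g τ with hf
  have h1 : projD L * star f * projD L = (star f - ∑ y : DSite L,
      star (g (.inl y)) • (star (c (.inl y) τ) * n (.inl y) (!τ))) * projD L := by
    rw [hf, star_lin, Fintype.sum_sum_type, mul_add, add_mul, sub_mul, add_mul, Finset.mul_sum,
      Finset.sum_mul, Finset.mul_sum, Finset.sum_mul, Finset.sum_mul, Finset.sum_mul,
      Finset.sum_mul, add_sub_right_comm, ← Finset.sum_sub_distrib]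
    congr 1
    · refine Finset.sum_congr rfl fun y _ => ?_
      rw [mul_smul_comm, smul_mul_assoc, projD_mul_star_c_inl_mul_projD, sub_mul, smul_sub,
        smul_mul_assoc, smul_mul_assoc]
    · refine Finset.sum_congr rfl fun u _ => ?_
      rw [mul_smul_comm, smul_mul_assoc,
        (commute_star_of_commute star_projD (commute_projD_c_inr u τ)).eq, mul_assoc,
        projD_mul_self, smul_mul_assoc]
  have h2 : ∀ y : DSite L, projD L * (f * (star (c (.inl y) τ) * n (.inl y) (!τ))) =
      g (.inl y) • (projD L * n (.inl y) (!τ)) := by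
    intro y
    have h3 : f * star (c (.inl y) τ) = g (.inl y) • 1 - star (c (.inl y) τ) * f := by
      rw [hf, c_eq_lin, lin_mul_star_lin]
      simp [Pi.single_apply, apply_ite]
    have h4 : Commute (n (.inl y) (!τ)) f := commute_n_lin_of_ne _ _ (by simp)
    rw [← mul_assoc f, h3, sub_mul, mul_assoc (star _), ← h4.eq, ← mul_assoc (star _), mul_sub,
      ← mul_assoc (projD L) (_ * _) f, projD_mul_star_c_inl_mul_n, zero_mul, sub_zero,
      smul_mul_assoc, one_mul, mul_smul_comm]
  calc projD L * f * projD L * star f * projD L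
      = projD L * f * (projD L * star f * projD L) := by simp only [mul_assoc]
    _ = projD L * (f * star f) * projD L - ∑ y : DSite L, star (g (.inl y)) •
          (projD L * (f * (star (c (.inl y) τ) * n (.inl y) (!τ))) * projD L) := by
        rw [h1, sub_mul, mul_sub, Finset.sum_mul, Finset.mul_sum]
        congr 1
        simp only [smul_mul_assoc, mul_smul_comm, mul_assoc]
    _ = _ := by
        simp only [h2]
        rw [hf, lin_mul_star_lin, ← hf, numOf_eq]
        rw [mul_sub _ (_ - _), sub_mul, Finset.mul_sum, Finset.sum_mul]
        congr 1
        refine Finset.sum_congr rfl fun y _ => ?_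
        rw [smul_mul_assoc, smul_smul, mul_smul_comm, smul_mul_assoc, mul_comm]

/-- The positive semidefinite form of the interaction terms: an electron of the opposite spin is
added to the orbital `g` when an electron of spin `σ` is removed from the orbital `h`. -/
theorem star_mul_self_hop (g h : Site L → ℂ) (σ : Spin)
    (hgh : ∀ y : DSite L, g (.inl y) * h (.inl y) = 0) :
    star (projD L * star (lin g (!σ)) * lin h σ * projD L) *
        (projD L * star (lin g (!σ)) * lin h σ * projD L) =
      projD L * (((∑ i, g i * star (g i)) • 1 - numOf (lin g (!σ)) -
        ∑ y : DSite L, (g (.inl y) * star (g (.inl y))) • n (.inl y) σ) * numOf (lin h σ)) *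
          projD L := by
  set f := lin g (!σ) with hf
  set e := lin h σ with he
  set X : Op L := (∑ i, g i * star (g i)) • 1 - numOf f -
    ∑ y : DSite L, (g (.inl y) * star (g (.inl y))) • n (.inl y) σ with hX
  have hXf : projD L * f * projD L * star f * projD L = projD L * X * projD L := by
    rw [hf, projD_lin_star_lin, Bool.not_not]
  have h1 : projD L * e * projD L = e * projD L := projD_mul_lin_mul_projD h σ
  have h2 : projD L * star e * projD L = projD L * star e := lowers_projD_star_lin h σ
  have hstarX : star X = X := by
    simp only [hX, star_sub, star_smul, star_sum, star_one, star_numOf, star_mul, star_star, n]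
  have hc : Commute X (star e) := by
    refine commute_star_of_commute hstarX ?_
    refine Commute.sub_left (Commute.sub_left ((Commute.one_left e).smul_left _)
      (commute_numOf_lin _ _ (by simp))) ?_
    -- A D-site in the support of `h` drops out of the correction, because `g` vanishes there.
    refine Commute.sum_left _ _ _ fun y _ => ?_
    by_cases hy : h (.inl y) = 0
    · exact (commute_n_lin _ hy _ _).smul_left _
    · have : g (.inl y) = 0 := by simpa [hy] using hgh y
      simp [this]
  calc _ = projD L * star e * f * (projD L * projD L) * star f * e * projD L := by
        simp only [star_mul, star_star, star_projD, mul_assoc]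
    _ = projD L * star e * f * projD L * star f * (e * projD L) := by
        rw [projD_mul_self]
        simp only [mul_assoc]
    _ = projD L * star e * (projD L * f * projD L * star f * projD L) * (e * projD L) := by
        rw [← h2, ← h1]
        simp only [mul_assoc]
        rw [← mul_assoc (projD L) (projD L), projD_mul_self, ← mul_assoc (projD L) (projD L),
          projD_mul_self]
    _ = projD L * star e * projD L * X * (projD L * e * projD L) := by
        rw [hXf]
        simp only [mul_assoc]
    _ = projD L * (star e * X) * e * projD L := by
        rw [h1, h2]
        simp only [mul_assoc]
    _ = _ := by
        rw [← hc.eq, numOf_eq]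
        simp only [mul_assoc]

end Operators

/-! ### The decorated lattice -/

section Lattice

variable {L : ℕ}

theorem one_ne_zero_zmod (hL : 3 ≤ L) : (1 : ZMod L) ≠ 0 := by
  have : Fact (1 < L) := ⟨by omega⟩
  exact one_ne_zero

theorem one_ne_neg_one_zmod (hL : 3 ≤ L) : (1 : ZMod L) ≠ -1 := by
  have : Fact (2 < L) := ⟨by omega⟩
  exact (ZMod.neg_one_ne_one).symm

theorem add_δ_ne (hL : 3 ≤ L) (x : DSite L) (l : Fin 2) : x + δ L l ≠ x := by
  intro h
  have := congrFun h l
  simp [δ, one_ne_zero_zmod hL] at this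

theorem sub_δ_ne (hL : 3 ≤ L) (x : DSite L) (l : Fin 2) : x - δ L l ≠ x := by
  intro h
  have := congrFun h l
  simp [δ, one_ne_zero_zmod hL] at this

theorem add_δ_ne_sub_δ (hL : 3 ≤ L) (x : DSite L) (l m : Fin 2) : x + δ L l ≠ x - δ L m := by
  intro h
  rcases eq_or_ne l m with rfl | hlm
  · have h1 := congrFun h l
    rw [Pi.add_apply, Pi.sub_apply, sub_eq_add_neg, add_right_inj, δ, Pi.single_eq_same] at h1
    exact one_ne_neg_one_zmod hL h1
  · have h1 := congrFun h l
    rw [Pi.add_apply, Pi.sub_apply, sub_eq_add_neg, add_right_inj, δ, δ, Pi.single_eq_same,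
      Pi.single_eq_of_ne hlm, neg_zero] at h1
    exact one_ne_zero_zmod hL h1

theorem δ_injective (hL : 3 ≤ L) : Function.Injective (δ L) := by
  intro l m h
  by_contra hlm
  have h1 := congrFun h l
  rw [δ, δ, Pi.single_eq_same, Pi.single_eq_of_ne hlm] at h1
  exact one_ne_zero_zmod hL h1

variable [NeZero L]

theorem mem_nbrs {x : DSite L} {u : PSite L} : u ∈ nbrs x ↔ x ∈ endpoints u := by
  simp [nbrs]

theorem sum_nbrs (hL : 3 ≤ L) {E : Type*} [AddCommMonoid E] (x : DSite L) (F : PSite L → E) :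
    ∑ u ∈ nbrs x, F u = ∑ l : Fin 2, (F (x, l) + F (x - δ L l, l)) := by
  rw [nbrs, Finset.sum_filter, Fintype.sum_prod_type_right]
  refine Finset.sum_congr rfl fun l _ => ?_
  have : ∀ y : DSite L, (if x ∈ endpoints (y, l) then F (y, l) else 0) =
      (if y = x then F (y, l) else 0) + (if y = x - δ L l then F (y, l) else 0) := by
    intro y
    by_cases h1 : y = x
    · subst h1
      simp [endpoints, (sub_δ_ne hL y l).symm]
    · by_cases h2 : y = x - δ L l
      · simp [endpoints, h2, sub_δ_ne hL]
      · have h3 : x ≠ y + δ L l := fun h => h2 (by rw [h, add_sub_cancel_right])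
        simp [endpoints, h1, h2, h3, Ne.symm h1]
  rw [Finset.sum_congr rfl fun y _ => this y, Finset.sum_add_distrib]
  simp

omit [NeZero L] in
theorem sum_endpoints (hL : 3 ≤ L) {E : Type*} [AddCommMonoid E] (u : PSite L) (F : DSite L → E) :
    ∑ x ∈ endpoints u, F x = F u.1 + F (u.1 + δ L u.2) :=
  Finset.sum_pair (add_δ_ne hL _ _).symm

end Lattice

/-! ### Coefficients of the orbitals -/

section Coefficients

variable {L : ℕ}

/-- The phase `exp (2 i Q · u)`: it is `1` on horizontal bonds and `-1` on vertical bonds. -/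
def phase (u : PSite L) : ℂ := if u.2 = 0 then 1 else -1

theorem phase_mul_self (u : PSite L) : phase u * phase u = 1 := by
  unfold phase
  split_ifs <;> simp

theorem star_phase (u : PSite L) : star (phase u) = phase u := by
  unfold phase
  split_ifs <;> simp

theorem phase_ne_zero (u : PSite L) : phase u ≠ 0 :=
  left_ne_zero_of_mul_eq_one (phase_mul_self u)

/-- The coefficients of the orbital `a_u`. -/
noncomputable def aCoef (α : ℝ) (u : PSite L) : Site L → ℂ :=
  Sum.elim (fun x => if x ∈ endpoints u then (α : ℂ) else 0) (fun v => if v = u then 1 else 0)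

variable [NeZero L]

omit [NeZero L] in
theorem exp_two_Qdot (u : PSite L) :
    Complex.exp (2 * Complex.I * (Qdot u : ℂ)) = phase u := by
  have h : (2 * Complex.I * (Qdot u : ℂ)) =
      ((u.1 1).val : ℕ) * (2 * Real.pi * Complex.I) +
        (if u.2 = 1 then Real.pi * Complex.I else 0) := by
    simp only [Qdot, Fin.sum_univ_two, Q, coord, Matrix.cons_val_zero, Matrix.cons_val_one]
    split_ifs <;> push_cast <;> ring
  rw [h, Complex.exp_add, Complex.exp_nat_mul_two_pi_mul_I, one_mul, phase]
  have h2 : u.2 = 0 ∨ u.2 = 1 := by omega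
  rcases h2 with h2 | h2 <;> simp [h2]

omit [NeZero L] in
theorem exp_neg_two_Qdot (u : PSite L) :
    Complex.exp (-2 * Complex.I * (Qdot u : ℂ)) = phase u := by
  have : (-2 * Complex.I * (Qdot u : ℂ)) = -(2 * Complex.I * (Qdot u : ℂ)) := by ring
  rw [this, Complex.exp_neg, exp_two_Qdot]
  exact inv_eq_of_mul_eq_one_left (phase_mul_self u)

/-- The coefficients of the orbital `b_x`. -/
noncomputable def bCoef (β : ℝ) (x : DSite L) : Site L → ℂ :=
  Sum.elim (fun y => if y = x then 1 else 0) (fun u => if u ∈ nbrs x then (β : ℂ) else 0)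

/-- The coefficients of the orbital `d_x`. -/
noncomputable def dCoef (α : ℝ) (x : DSite L) : Site L → ℂ :=
  fun i => ∑ u ∈ nbrs x, phase u * aCoef α u i

theorem a_eq_lin (α : ℝ) (u : PSite L) (σ : Spin) : a α u σ = lin (aCoef α u) σ := by
  rw [a, lin, Fintype.sum_sum_type, add_comm, Finset.smul_sum]
  simp [aCoef, ite_smul]

theorem b_eq_lin (β : ℝ) (x : DSite L) (σ : Spin) : b β x σ = lin (bCoef β x) σ := by
  rw [b, lin, Fintype.sum_sum_type, Finset.smul_sum]
  simp [bCoef, ite_smul]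

theorem d_eq_sum (α : ℝ) (x : DSite L) (σ : Spin) :
    d α x σ = ∑ u ∈ nbrs x, phase u • a α u σ := by
  simp only [d, exp_neg_two_Qdot]

theorem d_eq_lin (α : ℝ) (x : DSite L) (σ : Spin) : d α x σ = lin (dCoef α x) σ := by
  simp only [d_eq_sum, a_eq_lin, lin, dCoef, Finset.smul_sum, Finset.sum_smul, smul_smul]
  exact Finset.sum_comm

theorem dCoef_inr (α : ℝ) (x : DSite L) (v : PSite L) :
    dCoef α x (.inr v) = if v ∈ nbrs x then phase v else 0 := by
  simp [dCoef, aCoef]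

theorem dCoef_inl (hL : 3 ≤ L) (α : ℝ) (x y : DSite L) :
    dCoef α x (.inl y) = α * ∑ l : Fin 2, (if l = 0 then 1 else -1) *
      ((if y = x + δ L l then 1 else 0) + (if y = x - δ L l then 1 else 0)) := by
  have h1 : ∀ (z : DSite L) (l : Fin 2), (if z = x ∨ z = x + δ L l then (α : ℂ) else 0) =
      α * ((if z = x then 1 else 0) + (if z = x + δ L l then 1 else 0)) := by
    intro z l
    by_cases h : z = x
    · subst h
      simp [(add_δ_ne hL z l).symm]
    · simp [h]
  have h2 : ∀ (z : DSite L) (l : Fin 2), (if z = x - δ L l ∨ z = x then (α : ℂ) else 0) =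
      α * ((if z = x then 1 else 0) + (if z = x - δ L l then 1 else 0)) := by
    intro z l
    by_cases h : z = x
    · subst h
      simp [(sub_δ_ne hL z l).symm]
    · simp [h]
  rw [dCoef, sum_nbrs hL]
  simp only [phase, aCoef, endpoints, Sum.elim_inl, Finset.mem_insert, Finset.mem_singleton,
    sub_add_cancel, h1, h2, Fin.sum_univ_two, if_true]
  simp
  ring

/-- The two horizontal and the two vertical bonds at `x` contribute to `d_x` at the site `x` with
opposite signs. -/
theorem dCoef_inl_self (hL : 3 ≤ L) (α : ℝ) (x : DSite L) : dCoef α x (.inl x) = 0 := by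
  rw [dCoef_inl hL]
  simp [(add_δ_ne hL _ _).symm, (sub_δ_ne hL _ _).symm]

/-- The orbital `d_x` has weight `α²` on each of the four neighbours of `x`, which are distinct for
`L ≥ 3`, and no weight on the other D-sites. -/
theorem sum_dCoef_inl (hL : 3 ≤ L) (α : ℝ) (x : DSite L) {E : Type*} [AddCommGroup E] [Module ℂ E]
    (G : DSite L → E) :
    ∑ y, (dCoef α x (.inl y) * star (dCoef α x (.inl y))) • G y =
      (α : ℂ) ^ 2 • ∑ l : Fin 2, (G (x + δ L l) + G (x - δ L l)) := by
  have h01 : δ L 0 ≠ δ L 1 := fun h => absurd (δ_injective hL h) (by decide)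
  have h01' : x + δ L 0 ≠ x + δ L 1 := fun h => h01 (add_left_cancel h)
  have h01'' : x - δ L 0 ≠ x - δ L 1 := fun h => h01 (sub_right_injective h)
  have key : ∀ y, dCoef α x (.inl y) * star (dCoef α x (.inl y)) = (α : ℂ) ^ 2 *
      ∑ l : Fin 2, ((if y = x + δ L l then 1 else 0) + (if y = x - δ L l then 1 else 0)) := by
    intro y
    rw [dCoef_inl hL]
    simp only [Fin.sum_univ_two]
    by_cases h1 : y = x + δ L 0
    · subst h1
      simp [h01', add_δ_ne_sub_δ hL]
      ring
    by_cases h2 : y = x - δ L 0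
    · subst h2
      simp [h01'', (add_δ_ne_sub_δ hL _ _ _).symm]
      ring
    by_cases h3 : y = x + δ L 1
    · subst h3
      simp [h01'.symm, add_δ_ne_sub_δ hL]
      ring
    by_cases h4 : y = x - δ L 1
    · subst h4
      simp [h01''.symm, (add_δ_ne_sub_δ hL _ _ _).symm]
      ring
    simp [h1, h2, h3, h4]
  simp only [key, mul_smul, ← Finset.smul_sum]
  congr 1
  simp only [Finset.sum_smul, add_smul, ite_smul, one_smul, zero_smul]
  rw [Finset.sum_comm]
  simp [Finset.sum_add_distrib]

theorem norm_dCoef (hL : 3 ≤ L) (α : ℝ) (x : DSite L) :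
    ∑ i, dCoef α x i * star (dCoef α x i) = 4 * (1 + (α : ℂ) ^ 2) := by
  have h1 := sum_dCoef_inl hL α x (fun _ => (1 : ℂ))
  simp only [smul_eq_mul, mul_one] at h1
  have h2 : ∀ v, dCoef α x (.inr v) * star (dCoef α x (.inr v)) =
      if v ∈ nbrs x then 1 else 0 := by
    intro v
    rw [dCoef_inr]
    split_ifs
    · rw [star_phase, phase_mul_self]
    · simp
  rw [Fintype.sum_sum_type, h1]
  simp only [h2]
  rw [← Finset.sum_filter, Finset.filter_univ_mem, sum_nbrs hL]
  simp
  ring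

theorem sum_aCoef_inl (α : ℝ) (u : PSite L) {E : Type*} [AddCommGroup E] [Module ℂ E]
    (G : DSite L → E) :
    ∑ y, (aCoef α u (.inl y) * star (aCoef α u (.inl y))) • G y =
      (α : ℂ) ^ 2 • ∑ y ∈ endpoints u, G y := by
  simp [aCoef, apply_ite, ite_smul, Finset.smul_sum, sq]

theorem norm_aCoef (hL : 3 ≤ L) (α : ℝ) (u : PSite L) :
    ∑ i, aCoef α u i * star (aCoef α u i) = 1 + 2 * (α : ℂ) ^ 2 := by
  have h1 := sum_aCoef_inl α u (fun _ => (1 : ℂ))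
  simp only [smul_eq_mul, mul_one] at h1
  rw [Fintype.sum_sum_type, h1, sum_endpoints hL]
  simp [aCoef]
  ring

end Coefficients

/-! ### The Hamiltonian as a sum of squares -/

section Hamiltonian

variable {L : ℕ} [NeZero L]

/-- The operator `K` for which `K†K` is the part of `H / V₁` with the removal of an electron of spin
`σ` from the orbital `b_x`. -/
noncomputable def siteOp (p : Params) (x : DSite L) (σ : Spin) : Op L :=
  projD L * star (d p.α x (!σ)) * b p.β x σ * projD L

/-- The operator `K` for which `K†K` is the part of `H / V₂` with the removal of an electron of spin
`σ` from the P-site `u`. -/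
noncomputable def bondOp (p : Params) (u : PSite L) (σ : Spin) : Op L :=
  projD L * star (a p.α u (!σ)) * c (.inr u) σ * projD L

theorem star_siteOp_mul_self (hL : 3 ≤ L) (p : Params) (x : DSite L) (σ : Spin) :
    star (siteOp p x σ) * siteOp p x σ = projD L * (((4 * (1 + (p.α : ℂ) ^ 2)) • 1 -
      numOf (d p.α x (!σ)) - (p.α : ℂ) ^ 2 • ∑ l : Fin 2,
        (n (.inl (x + δ L l)) σ + n (.inl (x - δ L l)) σ)) * numOf (b p.β x σ)) * projD L := by
  rw [siteOp, d_eq_lin, b_eq_lin, star_mul_self_hop, norm_dCoef hL, sum_dCoef_inl hL]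
  intro y
  by_cases h : y = x
  · rw [h, dCoef_inl_self hL, zero_mul]
  · simp [bCoef, h]

theorem star_bondOp_mul_self (hL : 3 ≤ L) (p : Params) (u : PSite L) (σ : Spin) :
    star (bondOp p u σ) * bondOp p u σ = projD L * (((1 + 2 * (p.α : ℂ) ^ 2) • 1 -
      numOf (a p.α u (!σ)) - (p.α : ℂ) ^ 2 • ∑ x ∈ endpoints u, n (.inl x) σ) *
        n (.inr u) σ) * projD L := by
  rw [bondOp, a_eq_lin, n, c_eq_lin (.inr u), star_mul_self_hop, norm_aCoef hL, sum_aCoef_inl]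
  intro y
  simp

/-- At the given parameter values, the Hamiltonian is a sum of positive semidefinite terms. -/
theorem H_eq_sum (hL : 3 ≤ L) (p : Params)
    (ht : p.t = 4 * (1 + p.α ^ 2) * p.V₁) (hW₁ : p.W₁ = p.α ^ 2 * p.V₁)
    (hs : p.s = (1 + 2 * p.α ^ 2) * p.V₂) (hW₂ : p.W₂ = p.α ^ 2 * p.V₂) :
    H L p = (p.V₁ : ℂ) • ∑ x : DSite L, ∑ σ : Spin, star (siteOp p x σ) * siteOp p x σ +
      (p.V₂ : ℂ) • ∑ u : PSite L, ∑ σ : Spin, star (bondOp p u σ) * bondOp p u σ := by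
  have h1 : ∀ (x : DSite L) (σ : Spin), star (siteOp p x σ) * siteOp p x σ =
      projD L * ((4 * (1 + (p.α : ℂ) ^ 2)) • numOf (b p.β x σ)) * projD L -
      projD L * (numOf (d p.α x (!σ)) * numOf (b p.β x σ)) * projD L -
      (p.α : ℂ) ^ 2 • ∑ l : Fin 2, projD L * ((n (.inl (x + δ L l)) σ + n (.inl (x - δ L l)) σ) *
        numOf (b p.β x σ)) * projD L := by
    intro x σ
    rw [star_siteOp_mul_self hL]
    simp only [sub_mul, mul_sub, smul_mul_assoc, mul_smul_comm, one_mul, Finset.sum_mul,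
      Finset.mul_sum]
  have h2 : ∀ (u : PSite L) (σ : Spin), star (bondOp p u σ) * bondOp p u σ =
      projD L * ((1 + 2 * (p.α : ℂ) ^ 2) • n (.inr u) σ) * projD L -
      projD L * (numOf (a p.α u (!σ)) * n (.inr u) σ) * projD L -
      (p.α : ℂ) ^ 2 • ∑ x ∈ endpoints u, projD L * (n (.inl x) σ * n (.inr u) σ) * projD L := by
    intro u σ
    rw [star_bondOp_mul_self hL]
    simp only [sub_mul, mul_sub, smul_mul_assoc, mul_smul_comm, one_mul, Finset.sum_mul,
      Finset.mul_sum]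
  simp only [h1, h2, H, H0, Hint1, Hint2, ht, hW₁, hs, hW₂, mul_add, add_mul, mul_sub, sub_mul,
    mul_neg, neg_mul, mul_smul_comm, smul_mul_assoc, Finset.mul_sum, Finset.sum_mul,
    Finset.sum_sub_distrib, Finset.sum_add_distrib, smul_sub, smul_add, Finset.smul_sum, smul_smul]
  have e1 : ∀ f : Fin 2 → Spin → Op L, ∑ σ, ∑ l, f l σ = ∑ l, ∑ σ, f l σ :=
    fun f => Finset.sum_comm
  have e2 : ∀ (u : PSite L) (f : DSite L → Spin → Op L),
      ∑ σ, ∑ x ∈ endpoints u, f x σ = ∑ x ∈ endpoints u, ∑ σ, f x σ :=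
    fun u f => Finset.sum_comm
  simp only [e1, e2, Complex.ofReal_add, Complex.ofReal_mul, Complex.ofReal_pow,
    Complex.ofReal_one, Complex.ofReal_ofNat, mul_comm (p.V₁ : ℂ), mul_comm (p.V₂ : ℂ)]
  abel

end Hamiltonian

/-! ### The spaces of fixed electron number -/

section NumberSectors

variable {L : ℕ} [NeZero L]

theorem hasCharge_c (i : Site L) (σ : Spin) : HasCharge (-1) (c i σ) := hasCharge_annih _

theorem hasCharge_lin (g : Site L → ℂ) (σ : Spin) : HasCharge (-1) (lin g σ) :=
  HasCharge.sum fun i _ => (hasCharge_c i σ).smul _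

theorem hasCharge_star_lin (g : Site L → ℂ) (σ : Spin) : HasCharge 1 (star (lin g σ)) := by
  simpa using (hasCharge_lin g σ).star

theorem hasCharge_projD : HasCharge 0 (projD L) := by
  rw [projD_eq]
  exact hasCharge_proj _

theorem hasCharge_hop (g h : Site L → ℂ) (σ τ : Spin) :
    HasCharge 0 (projD L * star (lin g σ) * lin h τ * projD L) := by
  simpa using ((hasCharge_projD.mul (hasCharge_star_lin g σ)).mul (hasCharge_lin h τ)).mul
    hasCharge_projD

theorem hasCharge_siteOp (p : Params) (x : DSite L) (σ : Spin) : HasCharge 0 (siteOp p x σ) := by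
  rw [siteOp, d_eq_lin, b_eq_lin]
  exact hasCharge_hop _ _ _ _

theorem hasCharge_bondOp (p : Params) (u : PSite L) (σ : Spin) : HasCharge 0 (bondOp p u σ) := by
  rw [bondOp, a_eq_lin, c_eq_lin]
  exact hasCharge_hop _ _ _ _

/-- The modes of the factors of a basis state, in the order of the product. -/
noncomputable def modeList (A : Finset (DSite L)) (σ : DSite L → Spin)
    (Bup Bdn : Finset (PSite L)) : List (Mode L) :=
  (A.toList.map fun x => (.inl x, σ x)) ++ (Bup.toList.map fun u => (.inr u, true)) ++
    (Bdn.toList.map fun u => (.inr u, false))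

omit [NeZero L] in
theorem nodup_modeList (A : Finset (DSite L)) (σ : DSite L → Spin) (Bup Bdn : Finset (PSite L)) :
    (modeList A σ Bup Bdn).Nodup := by
  rw [modeList, List.nodup_append, List.nodup_append]
  refine ⟨⟨?_, ?_, ?_⟩, ?_, ?_⟩
  · exact A.nodup_toList.map fun x y h => by simpa using congrArg Prod.fst h
  · exact Bup.nodup_toList.map fun x y h => by simpa using congrArg Prod.fst h
  · intro q hq r hr
    simp only [List.mem_map] at hq hr
    obtain ⟨x, -, rfl⟩ := hq
    obtain ⟨u, -, rfl⟩ := hr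
    simp
  · exact Bdn.nodup_toList.map fun x y h => by simpa using congrArg Prod.fst h
  · intro q hq r hr
    simp only [List.mem_append, List.mem_map] at hq hr
    obtain ⟨u, -, rfl⟩ := hr
    rcases hq with ⟨x, -, rfl⟩ | ⟨x, -, rfl⟩ <;> simp

theorem exists_basisState_eq (A : Finset (DSite L)) (σ : DSite L → Spin)
    (Bup Bdn : Finset (PSite L)) : ∃ z : ℂ, z ≠ 0 ∧ basisState A σ Bup Bdn =
      z • EuclideanSpace.single (modeList A σ Bup Bdn).toFinset (1 : ℂ) := by
  obtain ⟨z, hz, h⟩ := prod_star_annih_vacuum _ (nodup_modeList A σ Bup Bdn)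
  refine ⟨z, hz, ?_⟩
  rw [← h, modeList, basisState, prodOver, prodOver, prodOver]
  simp only [List.map_append, List.prod_append, List.map_map]
  rfl

omit [NeZero L] in
theorem card_modeList (A : Finset (DSite L)) (σ : DSite L → Spin) (Bup Bdn : Finset (PSite L)) :
    (modeList A σ Bup Bdn).toFinset.card = A.card + Bup.card + Bdn.card := by
  rw [List.toFinset_card_of_nodup (nodup_modeList _ _ _ _)]
  simp [modeList, add_assoc]

omit [NeZero L] in
theorem noDouble_modeList (A : Finset (DSite L)) (σ : DSite L → Spin)
    (Bup Bdn : Finset (PSite L)) : NoDouble (modeList A σ Bup Bdn).toFinset := by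
  rintro x ⟨h1, h2⟩
  simp [modeList] at h1 h2
  rw [h1.2] at h2
  simp at h2

theorem exists_modeList_eq {S : Finset (Mode L)} (hS : NoDouble S) :
    ∃ A σ Bup Bdn, (modeList A σ Bup Bdn).toFinset = S := by
  classical
  refine ⟨Finset.univ.filter fun x => (.inl x, true) ∈ S ∨ (.inl x, false) ∈ S,
    fun x => decide ((.inl x, true) ∈ S), Finset.univ.filter fun u => (.inr u, true) ∈ S,
    Finset.univ.filter fun u => (.inr u, false) ∈ S, ?_⟩
  ext ⟨i, τ⟩
  rcases i with x | u
  · have := hS x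
    cases τ <;> simp [modeList] <;> tauto
  · cases τ <;> simp [modeList]

/-- The space spanned by the basis states is the joint eigenspace of `projD` and of the particle
number. -/
theorem mem_hilbert_iff {N : ℕ} {Ψ : Fk L} :
    Ψ ∈ hilbert L N ↔ projD L Ψ = Ψ ∧ totalNum (Mode L) Ψ = (N : ℂ) • Ψ := by
  constructor
  · intro h
    induction h using Submodule.span_induction with
    | mem Ψ h =>
      obtain ⟨A, σ, Bup, Bdn, hN, rfl⟩ := h
      obtain ⟨z, -, hz⟩ := exists_basisState_eq A σ Bup Bdn
      rw [hz, projD_eq, proj_eq_self_iff, totalNum_eq_iff]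
      have key : ∀ S, (z • EuclideanSpace.single (modeList A σ Bup Bdn).toFinset (1 : ℂ) : Fk L) S
          ≠ 0 → S = (modeList A σ Bup Bdn).toFinset := by
        intro S hS
        by_contra hne
        simp [hne] at hS
      constructor
      · intro S hS
        rw [key S hS]
        exact noDouble_modeList _ _ _ _
      · intro S hS
        rw [key S hS, card_modeList, hN]
    | zero => simp
    | add Ψ Φ _ _ h1 h2 => simp [map_add, h1.1, h1.2, h2.1, h2.2]
    | smul z Ψ _ h => exact ⟨by rw [map_smul, h.1], by rw [map_smul, h.2, smul_comm]⟩
  · rintro ⟨h1, h2⟩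
    rw [projD_eq, proj_eq_self_iff] at h1
    rw [totalNum_eq_iff] at h2
    have : Ψ = ∑ S, Ψ S • EuclideanSpace.single S (1 : ℂ) := by
      ext T
      simp [Pi.single_apply]
    rw [this]
    refine Submodule.sum_mem _ fun S _ => ?_
    by_cases hS : Ψ S = 0
    · rw [hS, zero_smul]
      exact Submodule.zero_mem _
    refine Submodule.smul_mem _ _ ?_
    obtain ⟨A, σ, Bup, Bdn, h⟩ := exists_modeList_eq (h1 S hS)
    obtain ⟨z, hz, hb⟩ := exists_basisState_eq A σ Bup Bdn
    have h3 : EuclideanSpace.single S (1 : ℂ) = z⁻¹ • basisState A σ Bup Bdn := by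
      rw [hb, h, smul_smul, inv_mul_cancel₀ hz, one_smul]
    rw [h3]
    refine Submodule.smul_mem _ _ (Submodule.subset_span ⟨A, σ, Bup, Bdn, ?_, rfl⟩)
    rw [← card_modeList A σ, h, h2 S hS]

theorem exists_mem_hilbert_ne_zero {N : ℕ} (hN : N ≤ 2 * Fintype.card (PSite L)) :
    ∃ Φ ∈ hilbert L N, Φ ≠ 0 := by
  have hinj : Function.Injective fun q : PSite L × Spin => ((.inr q.1, q.2) : Mode L) := by
    rintro ⟨u, σ⟩ ⟨v, τ⟩ h
    simpa using h
  have hcard : (Finset.univ.image fun q : PSite L × Spin => ((.inr q.1, q.2) : Mode L)).card =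
      2 * Fintype.card (PSite L) := by
    rw [Finset.card_image_of_injective _ hinj, Finset.card_univ, Fintype.card_prod,
      Fintype.card_bool, mul_comm]
  obtain ⟨S, hS, hc⟩ := Finset.exists_subset_card_eq (hcard ▸ hN)
  have key : ∀ T, (EuclideanSpace.single S (1 : ℂ) : Fk L) T ≠ 0 → T = S := by
    intro T hT
    by_contra hne
    simp [hne] at hT
  refine ⟨EuclideanSpace.single S 1, mem_hilbert_iff.mpr ⟨?_, ?_⟩, by simp⟩
  · rw [projD_eq, proj_eq_self_iff]
    intro T hT x hx
    rw [key T hT] at hx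
    simpa using hS hx.1
  · rw [totalNum_eq_iff]
    intro T hT
    rw [key T hT, hc]

end NumberSectors

/-! ### Eigenvalues of the sum of squares -/

section Spectrum

variable {L : ℕ} [NeZero L]

/-- The sum of squares of the interaction operators, to which the Hamiltonian is equal at the
parameter values of the exactly solvable model. -/
noncomputable def sosHamiltonian (p : Params) : Op L :=
  (p.V₁ : ℂ) • ∑ x : DSite L, ∑ σ : Spin, star (siteOp p x σ) * siteOp p x σ +
    (p.V₂ : ℂ) • ∑ u : PSite L, ∑ σ : Spin, star (bondOp p u σ) * bondOp p u σ

theorem inner_star_mul_self (T : Op L) (Ψ : Fk L) :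
    inner ℂ Ψ ((star T * T) Ψ) = ((‖T Ψ‖ ^ 2 : ℝ) : ℂ) := by
  rw [Module.End.mul_apply, ← inner_star_left, star_star, inner_self_eq_norm_sq_to_K]
  norm_cast

theorem inner_sosHamiltonian (p : Params) (Ψ : Fk L) :
    inner ℂ Ψ (sosHamiltonian p Ψ) =
      ((p.V₁ * ∑ x : DSite L, ∑ σ : Spin, ‖siteOp p x σ Ψ‖ ^ 2 +
        p.V₂ * ∑ u : PSite L, ∑ σ : Spin, ‖bondOp p u σ Ψ‖ ^ 2 : ℝ) : ℂ) := by
  simp only [sosHamiltonian, LinearMap.add_apply, LinearMap.smul_apply, LinearMap.sum_apply,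
    inner_add_right, inner_smul_right, inner_sum, inner_star_mul_self, Complex.ofReal_add,
    Complex.ofReal_mul, Complex.ofReal_sum]

theorem eigenvalue_nonneg {p : Params} (hV₁ : 0 < p.V₁) (hV₂ : 0 < p.V₂) {E : ℝ} {Ψ : Fk L}
    (hΨ : Ψ ≠ 0) (h : sosHamiltonian p Ψ = (E : ℂ) • Ψ) : 0 ≤ E := by
  have h1 := inner_sosHamiltonian p Ψ
  rw [h, inner_smul_right, inner_self_eq_norm_sq_to_K] at h1
  have h2 : E * ‖Ψ‖ ^ 2 = p.V₁ * ∑ x : DSite L, ∑ σ : Spin, ‖siteOp p x σ Ψ‖ ^ 2 +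
        p.V₂ * ∑ u : PSite L, ∑ σ : Spin, ‖bondOp p u σ Ψ‖ ^ 2 := by
    exact Complex.ofReal_injective (by rw [← h1]; push_cast; rfl)
  have h3 : 0 ≤ E * ‖Ψ‖ ^ 2 := by
    rw [h2]
    positivity
  exact nonneg_of_mul_nonneg_left h3 (by positivity)

theorem sosHamiltonian_eq_zero_iff {p : Params} (hV₁ : 0 < p.V₁) (hV₂ : 0 < p.V₂) {Ψ : Fk L} :
    sosHamiltonian p Ψ = 0 ↔
      (∀ x σ, siteOp p x σ Ψ = 0) ∧ ∀ u σ, bondOp p u σ Ψ = 0 := by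
  constructor
  · intro h
    have h1 := inner_sosHamiltonian p Ψ
    rw [h, inner_zero_right] at h1
    have h2 : p.V₁ * ∑ x : DSite L, ∑ σ : Spin, ‖siteOp p x σ Ψ‖ ^ 2 +
        p.V₂ * ∑ u : PSite L, ∑ σ : Spin, ‖bondOp p u σ Ψ‖ ^ 2 = 0 := by
      exact_mod_cast h1.symm
    have h3 : 0 ≤ ∑ x : DSite L, ∑ σ : Spin, ‖siteOp p x σ Ψ‖ ^ 2 := by positivity
    have h4 : 0 ≤ ∑ u : PSite L, ∑ σ : Spin, ‖bondOp p u σ Ψ‖ ^ 2 := by positivity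
    have h5 : ∑ x : DSite L, ∑ σ : Spin, ‖siteOp p x σ Ψ‖ ^ 2 = 0 := by nlinarith
    have h6 : ∑ u : PSite L, ∑ σ : Spin, ‖bondOp p u σ Ψ‖ ^ 2 = 0 := by nlinarith
    constructor
    · intro x σ
      rw [Finset.sum_eq_zero_iff_of_nonneg fun x _ => by positivity] at h5
      have := h5 x (Finset.mem_univ _)
      rw [Finset.sum_eq_zero_iff_of_nonneg fun σ _ => by positivity] at this
      simpa using this σ (Finset.mem_univ _)
    · intro u σ
      rw [Finset.sum_eq_zero_iff_of_nonneg fun x _ => by positivity] at h6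
      have := h6 u (Finset.mem_univ _)
      rw [Finset.sum_eq_zero_iff_of_nonneg fun σ _ => by positivity] at this
      simpa using this σ (Finset.mem_univ _)
  · rintro ⟨h1, h2⟩
    simp [sosHamiltonian, LinearMap.sum_apply, h1, h2]

theorem star_sosHamiltonian (p : Params) :
    star (sosHamiltonian p : Op L) = sosHamiltonian p := by
  simp [sosHamiltonian, star_sum, star_smul]

theorem projD_mul_sosHamiltonian (p : Params) :
    projD L * sosHamiltonian p = sosHamiltonian p := by
  have h1 : ∀ x σ, projD L * (star (siteOp p x σ) * siteOp p x σ) =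
      star (siteOp p x σ) * siteOp p x σ := by
    intro x σ
    have : projD L * star (siteOp p x σ) = star (siteOp p x σ) := by
      simp only [siteOp, star_mul, star_projD, ← mul_assoc, projD_mul_self]
    rw [← mul_assoc, this]
  have h2 : ∀ u σ, projD L * (star (bondOp p u σ) * bondOp p u σ) =
      star (bondOp p u σ) * bondOp p u σ := by
    intro u σ
    have : projD L * star (bondOp p u σ) = star (bondOp p u σ) := by
      simp only [bondOp, star_mul, star_projD, ← mul_assoc, projD_mul_self]
    rw [← mul_assoc, this]
  simp only [sosHamiltonian, mul_add, mul_smul_comm, Finset.mul_sum, h1, h2]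

theorem hasCharge_sosHamiltonian (p : Params) : HasCharge 0 (sosHamiltonian p : Op L) := by
  refine HasCharge.add (HasCharge.smul _ (HasCharge.sum fun x _ => HasCharge.sum fun σ _ => ?_))
    (HasCharge.smul _ (HasCharge.sum fun u _ => HasCharge.sum fun σ _ => ?_))
  · simpa using (hasCharge_siteOp p x σ).star.mul (hasCharge_siteOp p x σ)
  · simpa using (hasCharge_bondOp p u σ).star.mul (hasCharge_bondOp p u σ)

theorem sosHamiltonian_mem_hilbert (p : Params) {N : ℕ} {Ψ : Fk L} (h : Ψ ∈ hilbert L N) :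
    sosHamiltonian p Ψ ∈ hilbert L N := by
  rw [mem_hilbert_iff] at h ⊢
  refine ⟨LinearMap.congr_fun (projD_mul_sosHamiltonian p) Ψ, ?_⟩
  simpa using (hasCharge_sosHamiltonian p).apply h.2

theorem exists_isLeast_eigenvalue (p : Params) {N : ℕ}
    (hN : N ≤ 2 * Fintype.card (PSite L)) :
    ∃ E : ℝ, IsLeast {E : ℝ | ∃ Φ ∈ hilbert L N, Φ ≠ 0 ∧
      sosHamiltonian p Φ = (E : ℂ) • Φ} E := by
  set s : Set ℝ := {E : ℝ | ∃ Φ ∈ hilbert L N, Φ ≠ 0 ∧ sosHamiltonian p Φ = (E : ℂ) • Φ}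
  have hfin : s.Finite := by
    refine Set.Finite.subset ((Module.End.finite_hasEigenvalue
      (sosHamiltonian p : Op L)).preimage Complex.ofReal_injective.injOn) ?_
    rintro E ⟨Φ, -, h0, hΦ⟩
    exact Module.End.hasEigenvalue_of_hasEigenvector
      ⟨Module.End.mem_eigenspace_iff.mpr hΦ, h0⟩
  have hsymm : (sosHamiltonian p : Op L).IsSymmetric := by
    intro Ψ Φ
    rw [← inner_star_left, star_sosHamiltonian]
  have hne : s.Nonempty := by
    -- On a nontrivial invariant subspace, the infimum of the Rayleigh quotient is an eigenvalue.
    obtain ⟨Φ₀, hΦ₀, h0⟩ := exists_mem_hilbert_ne_zero hN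
    have : Nontrivial (hilbert L N) :=
      ⟨⟨⟨Φ₀, hΦ₀⟩, 0, fun h => h0 (congrArg Subtype.val h)⟩⟩
    have hinv : ∀ v ∈ hilbert L N, sosHamiltonian p v ∈ hilbert L N :=
      fun v hv => sosHamiltonian_mem_hilbert p hv
    obtain ⟨E, hE⟩ : ∃ E : ℝ, Module.End.HasEigenvalue
        ((sosHamiltonian p : Op L).restrict hinv) (E : ℂ) :=
      ⟨_, (hsymm.restrict_invariant hinv).hasEigenvalue_iInf_of_finiteDimensional⟩
    obtain ⟨Φ, hΦ⟩ := hE.exists_hasEigenvector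
    refine ⟨E, Φ.1, Φ.2, fun h => hΦ.2 (Subtype.ext h), ?_⟩
    exact congrArg Subtype.val hΦ.apply_eq_smul
  obtain ⟨E, hE, hmin⟩ := Set.exists_min_image s id hfin hne
  exact ⟨E, hE, hmin⟩

end Spectrum

/-! ### Conjugation by exponentials of nilpotents -/

section Exponential

theorem mul_pow_of_commutator {A : Type*} [Ring A] {X Y K : A} (h : Y * X = X * Y + K)
    (hK : Commute K X) (i : ℕ) : Y * X ^ i = X ^ i * Y + (i : A) * (X ^ (i - 1) * K) := by
  induction i with
  | zero => simp
  | succ i ih =>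
    rw [pow_succ, ← mul_assoc, ih, add_mul, mul_assoc (X ^ i) Y X, h, mul_add, Nat.add_sub_cancel,
      mul_assoc (i : A), mul_assoc (X ^ (i - 1)), hK.eq, ← mul_assoc (X ^ (i - 1)), ← mul_assoc,
      add_assoc]
    congr 1
    rcases i with _ | i
    · simp
    · rw [Nat.add_sub_cancel, ← pow_succ]
      push_cast
      noncomm_ring

/-- If the commutator `K` of `Y` with a nilpotent `X` commutes with `X`, conjugation by the
exponential of `X` translates `Y` by `K`. -/
theorem mul_exp_of_commutator {A : Type*} [Ring A] [Module ℚ A] {X Y K : A} (hX : IsNilpotent X)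
    (h : Y * X = X * Y + K) (hK : Commute K X) :
    Y * IsNilpotent.exp X = IsNilpotent.exp X * (Y + K) := by
  obtain ⟨k, hk⟩ := hX
  have hk' : X ^ (k + 1) = 0 := by rw [pow_succ, hk, zero_mul]
  rw [mul_add]
  nth_rewrite 1 2 [IsNilpotent.exp_eq_sum hk']
  rw [IsNilpotent.exp_eq_sum hk, Finset.mul_sum, Finset.sum_mul, Finset.sum_mul]
  have : ∀ i : ℕ, Y * ((i.factorial : ℚ)⁻¹ • X ^ i) = (i.factorial : ℚ)⁻¹ • X ^ i * Y +
      (i.factorial : ℚ)⁻¹ • ((i : A) * (X ^ (i - 1) * K)) := by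
    intro i
    rw [mul_smul_comm, mul_pow_of_commutator h hK, smul_add, smul_mul_assoc]
  rw [Finset.sum_congr rfl fun i _ => this i, Finset.sum_add_distrib]
  congr 1
  rw [Finset.sum_range_succ']
  simp only [Nat.cast_zero, zero_mul, smul_zero, add_zero]
  refine Finset.sum_congr rfl fun i _ => ?_
  rw [Nat.add_sub_cancel, ← nsmul_eq_mul, ← Nat.cast_smul_eq_nsmul ℚ, smul_smul, smul_mul_assoc]
  congr 1
  rw [Nat.factorial_succ]
  push_cast
  field_simp

end Exponential

/-! ### The dressing operator -/

section Dressing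

variable {L : ℕ} [NeZero L]

/-- The part of the orbital `a_u` on the D-sites. -/
noncomputable def tail (α : ℝ) (u : PSite L) (σ : Spin) : Op L :=
  (α : ℂ) • ∑ x ∈ endpoints u, c (.inl x) σ

theorem tail_eq_lin (α : ℝ) (u : PSite L) (σ : Spin) : tail α u σ =
    lin (Sum.elim (fun x => if x ∈ endpoints u then (α : ℂ) else 0) fun _ => 0) σ := by
  rw [tail, lin, Fintype.sum_sum_type, Finset.smul_sum]
  simp [ite_smul]

theorem c_inr_mul_star_tail (α : ℝ) (u v : PSite L) (σ τ : Spin) :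
    c (.inr v) τ * star (tail α u σ) = -(star (tail α u σ) * c (.inr v) τ) := by
  rw [tail_eq_lin, c_eq_lin]
  by_cases h : τ = σ
  · subst h
    rw [lin_mul_star_lin]
    simp [Pi.single_apply]
  · exact lin_mul_star_lin_of_ne _ _ h

theorem star_tail_mul_star_tail (α : ℝ) (u v : PSite L) (σ τ : Spin) :
    star (tail α u σ) * star (tail α v τ) = -(star (tail α v τ) * star (tail α u σ)) := by
  rw [tail_eq_lin, tail_eq_lin, star_lin_mul_star_lin]

theorem star_tail_mul_self (α : ℝ) (u : PSite L) (σ : Spin) :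
    star (tail α u σ) * star (tail α u σ) = 0 := by
  rw [tail_eq_lin, star_lin_mul_self]

variable (L) in
/-- The generator of the dressing: it moves electrons from the P-sites to the neighbouring
D-sites with amplitude `α`. -/
noncomputable def dressGen (α : ℝ) : Op L :=
  ∑ q : PSite L × Spin, star (tail α q.1 q.2) * c (.inr q.1) q.2

theorem commute_hop_c_inr (α : ℝ) (u v : PSite L) (σ τ : Spin) :
    Commute (star (tail α u σ) * c (.inr u) σ) (c (.inr v) τ) :=
  commute_mul_of_anticommute (by rw [c_inr_mul_star_tail, neg_neg]) (c_mul_c _ _ _ _)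

theorem commute_hop_star_tail (α : ℝ) (u v : PSite L) (σ τ : Spin) :
    Commute (star (tail α u σ) * c (.inr u) σ) (star (tail α v τ)) :=
  commute_mul_of_anticommute (star_tail_mul_star_tail _ _ _ _ _) (c_inr_mul_star_tail _ _ _ _ _)

theorem isNilpotent_dressGen (α : ℝ) : IsNilpotent (dressGen L α) := by
  refine Commute.isNilpotent_sum (fun q _ => ⟨2, ?_⟩) fun q r _ _ =>
    (commute_hop_star_tail α _ _ _ _).mul_right (commute_hop_c_inr α _ _ _ _)
  rw [pow_two, mul_assoc, ← mul_assoc (c _ _), c_inr_mul_star_tail, neg_mul, mul_neg, ← mul_assoc,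
    ← mul_assoc, star_tail_mul_self, zero_mul, zero_mul, neg_zero]

theorem commute_dressGen_c_inr (α : ℝ) (v : PSite L) (τ : Spin) :
    Commute (dressGen L α) (c (.inr v) τ) :=
  Commute.sum_left _ _ _ fun _ _ => commute_hop_c_inr _ _ _ _ _

theorem commute_dressGen_star_tail (α : ℝ) (v : PSite L) (τ : Spin) :
    Commute (dressGen L α) (star (tail α v τ)) :=
  Commute.sum_left _ _ _ fun _ _ => commute_hop_star_tail _ _ _ _ _

theorem star_c_inr_mul_dressGen (α : ℝ) (v : PSite L) (τ : Spin) :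
    star (c (.inr v) τ) * dressGen L α = dressGen L α * star (c (.inr v) τ) +
      -star (tail α v τ) := by
  have h : ∀ q : PSite L × Spin, star (c (.inr v) τ) * (star (tail α q.1 q.2) * c (.inr q.1) q.2) =
      star (tail α q.1 q.2) * c (.inr q.1) q.2 * star (c (.inr v) τ) +
        if q = (v, τ) then -star (tail α v τ) else 0 := by
    rintro ⟨u, σ⟩
    have h1 : star (c (.inr v) τ) * star (tail α u σ) =
        -(star (tail α u σ) * star (c (.inr v) τ)) := by
      rw [tail_eq_lin, c_eq_lin, star_lin_mul_star_lin]
    rw [← mul_assoc, h1, mul_assoc (star (tail α u σ)) (c _ _), c_mul_star_c, neg_mul, mul_sub,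
      mul_assoc]
    by_cases h : (u, σ) = (v, τ)
    · obtain ⟨rfl, rfl⟩ := Prod.mk.inj h
      simp only [if_true, mul_one]
      abel
    · have : ¬((Sum.inr u : Site L), σ) = (.inr v, τ) := by simpa using h
      simp [h, this]
  rw [dressGen, Finset.mul_sum, Finset.sum_congr rfl fun q _ => h q, Finset.sum_add_distrib,
    Finset.sum_mul, Finset.sum_ite_eq' _ (v, τ), if_pos (Finset.mem_univ _)]

theorem c_inl_mul_dressGen (α : ℝ) (y : DSite L) (τ : Spin) :
    c (.inl y) τ * dressGen L α = dressGen L α * c (.inl y) τ +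
      (α : ℂ) • ∑ u ∈ nbrs y, c (.inr u) τ := by
  have h : ∀ q : PSite L × Spin, c (.inl y) τ * (star (tail α q.1 q.2) * c (.inr q.1) q.2) =
      star (tail α q.1 q.2) * c (.inr q.1) q.2 * c (.inl y) τ +
        if q.2 = τ then (if q.1 ∈ nbrs y then (α : ℂ) • c (.inr q.1) τ else 0) else 0 := by
    rintro ⟨u, σ⟩
    have h1 : c (.inl y) τ * star (tail α u σ) =
        (if σ = τ then (if u ∈ nbrs y then (α : ℂ) • 1 else 0) else 0) -
          star (tail α u σ) * c (.inl y) τ := by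
      rw [tail_eq_lin, c_eq_lin]
      by_cases h : σ = τ
      · subst h
        rw [lin_mul_star_lin, if_pos rfl, Fintype.sum_sum_type]
        simp [Pi.single_apply, mem_nbrs, apply_ite]
      · rw [lin_mul_star_lin_of_ne _ _ (Ne.symm h), if_neg h, zero_sub]
    rw [← mul_assoc, h1, sub_mul, mul_assoc, c_mul_c, mul_neg, sub_neg_eq_add, add_comm, mul_assoc]
    congr 1
    by_cases h : σ = τ
    · subst h
      by_cases h' : u ∈ nbrs y <;> simp [h']
    · simp [h]
  rw [dressGen, Finset.mul_sum, Finset.sum_congr rfl fun q _ => h q, Finset.sum_add_distrib,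
    Finset.sum_mul]
  congr 1
  rw [Fintype.sum_prod_type]
  simp [Finset.smul_sum]

theorem hasCharge_dressGen (α : ℝ) : HasCharge 0 (dressGen L α) := by
  refine HasCharge.sum fun q _ => ?_
  rw [tail_eq_lin]
  simpa using (hasCharge_star_lin _ _).mul (hasCharge_c _ _)

theorem dressGen_vacuum (α : ℝ) : dressGen L α vacuum = 0 := by
  simp only [dressGen, LinearMap.sum_apply, Module.End.mul_apply]
  refine Finset.sum_eq_zero fun q _ => ?_
  rw [c, annih_vacuum, map_zero]

variable (L) in
/-- The dressing operator. Conjugation by it turns the creation operators of the P-sites into those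
of the orbitals `a_u`, and fixes the creation operators of the D-sites. -/
noncomputable def dress (α : ℝ) : Op L := IsNilpotent.exp (dressGen L α)

variable (L) in
/-- The inverse of the dressing operator. -/
noncomputable def undress (α : ℝ) : Op L := IsNilpotent.exp (-dressGen L α)

theorem dress_mul_undress (α : ℝ) : dress L α * undress L α = 1 :=
  IsNilpotent.exp_mul_exp_neg_self (isNilpotent_dressGen α)

theorem undress_mul_dress (α : ℝ) : undress L α * dress L α = 1 :=
  IsNilpotent.exp_neg_mul_exp_self (isNilpotent_dressGen α)

theorem c_inr_mul_dress (α : ℝ) (v : PSite L) (τ : Spin) :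
    c (.inr v) τ * dress L α = dress L α * c (.inr v) τ := by
  have := mul_exp_of_commutator (isNilpotent_dressGen α)
    (show c (.inr v) τ * dressGen L α = dressGen L α * c (.inr v) τ + 0 by
      rw [add_zero, (commute_dressGen_c_inr α v τ).eq]) (Commute.zero_left _)
  rwa [add_zero] at this

theorem c_inl_mul_dress (α : ℝ) (y : DSite L) (τ : Spin) :
    c (.inl y) τ * dress L α =
      dress L α * (c (.inl y) τ + (α : ℂ) • ∑ u ∈ nbrs y, c (.inr u) τ) :=
  mul_exp_of_commutator (isNilpotent_dressGen α) (c_inl_mul_dressGen α y τ)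
    ((Commute.sum_left _ _ _ fun _ _ => (commute_dressGen_c_inr _ _ _).symm).smul_left _)

theorem star_a_mul_dress (α : ℝ) (v : PSite L) (τ : Spin) :
    star (a α v τ) * dress L α = dress L α * star (c (.inr v) τ) := by
  have h1 := mul_exp_of_commutator (isNilpotent_dressGen α) (star_c_inr_mul_dressGen α v τ)
    (commute_dressGen_star_tail α v τ).symm.neg_left
  have h2 := mul_exp_of_commutator (isNilpotent_dressGen α)
    (show star (tail α v τ) * dressGen L α = dressGen L α * star (tail α v τ) + 0 by
      rw [add_zero, (commute_dressGen_star_tail α v τ).eq]) (Commute.zero_left _)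
  have h3 : a α v τ = c (.inr v) τ + tail α v τ := rfl
  rw [h3, star_add, add_mul, dress, h1, h2, ← mul_add]
  congr 1
  abel

/-- A property that is preserved by the operations of the algebra passes from `X` to `exp X`. -/
theorem exp_induction {p : Op L → Prop} {X : Op L} (hone : p 1)
    (hadd : ∀ T U, p T → p U → p (T + U))
    (hsmul : ∀ (z : ℂ) T, p T → p (z • T)) (hmul : ∀ T U, p T → p U → p (T * U)) (hX : p X) :
    p (IsNilpotent.exp X) := by
  have hpow : ∀ i : ℕ, p (X ^ i) := by
    intro i
    induction i with
    | zero => rwa [pow_zero]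
    | succ i ih => rw [pow_succ]; exact hmul _ _ ih hX
  have hzero : p 0 := by simpa using hsmul 0 1 hone
  refine Finset.sum_induction _ p hadd hzero fun i _ => ?_
  have : ((i.factorial : ℚ)⁻¹ • X ^ i) = (((i.factorial : ℚ)⁻¹ : ℚ) : ℂ) • X ^ i := by
    rw [← Rat.cast_smul_eq_qsmul ℂ]
  rw [this]
  exact hsmul _ _ (hpow i)

theorem dress_vacuum (α : ℝ) : dress L α vacuum = vacuum := by
  have h1 := IsNilpotent.exp_eq_sum (a := dressGen L α)
    (k := (isNilpotent_dressGen α).choose + 1) (by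
      rw [pow_succ, (isNilpotent_dressGen α).choose_spec, zero_mul])
  rw [dress, h1, Finset.sum_range_succ', LinearMap.add_apply, LinearMap.sum_apply]
  simp [pow_succ, dressGen_vacuum]

theorem hasCharge_undress (α : ℝ) : HasCharge 0 (undress L α) :=
  exp_induction hasCharge_one (fun _ _ => HasCharge.add) (fun z _ => HasCharge.smul z)
    (fun _ _ hT hU => by simpa using hT.mul hU)
    (by rw [← neg_one_smul ℂ]; exact (hasCharge_dressGen α).smul (-1))

/-- A condition on configurations that concerns the D-sites only, and that is inherited by smaller
configurations. -/
structure IsDecreasingOnD (q : Finset (Mode L) → Prop) : Prop where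
  erase : ∀ S m, q S → q (S.erase m)
  insert_inr : ∀ S u σ, q (insert (.inr u, σ) S) ↔ q S

omit [NeZero L] in
theorem isDecreasingOnD_noDouble : IsDecreasingOnD (L := L) NoDouble where
  erase _ _ h := h.mono (Finset.erase_subset _ _)
  insert_inr := noDouble_insert_inr

namespace IsDecreasingOnD

variable {q : Finset (Mode L) → Prop}

theorem commute_c_inr (hq : IsDecreasingOnD q) (u : PSite L) (σ : Spin) :
    Commute (proj q) (c (.inr u) σ) :=
  commute_proj_annih fun S => hq.insert_inr S u σ

theorem commute_star_c_inr (hq : IsDecreasingOnD q) (u : PSite L) (σ : Spin) :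
    Commute (proj q) (star (c (.inr u) σ)) :=
  commute_star_of_commute (star_proj q) (hq.commute_c_inr u σ)

theorem lowers_star_lin (hq : IsDecreasingOnD q) (g : Site L → ℂ) (σ : Spin) :
    Lowers (proj q) (star (lin g σ)) := by
  rw [star_lin]
  exact Lowers.sum fun i _ => Lowers.smul _ (lowers_star_annih hq.erase _)

theorem lowers_dressGen (hq : IsDecreasingOnD q) (α : ℝ) :
    Lowers (proj q) (dressGen L α) := by
  refine Lowers.sum fun r _ => Lowers.mul ?_
    (lowers_of_commute (proj_mul_self q) (hq.commute_c_inr _ _))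
  rw [tail_eq_lin]
  exact hq.lowers_star_lin _ _

theorem lowers_undress (hq : IsDecreasingOnD q) (α : ℝ) : Lowers (proj q) (undress L α) :=
  exp_induction (lowers_of_commute (proj_mul_self q) (Commute.one_right _))
    (fun _ _ => Lowers.add) (fun z _ => Lowers.smul z) (fun _ _ => Lowers.mul)
    (by rw [← neg_one_smul ℂ]; exact (hq.lowers_dressGen α).smul (-1))

theorem lowers_dress (hq : IsDecreasingOnD q) (α : ℝ) : Lowers (proj q) (dress L α) :=
  exp_induction (lowers_of_commute (proj_mul_self q) (Commute.one_right _))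
    (fun _ _ => Lowers.add) (fun z _ => Lowers.smul z) (fun _ _ => Lowers.mul)
    (hq.lowers_dressGen α)

/-- The projected dressing is injective on the range of the projection. -/
theorem proj_eq_zero_of_proj_dress (hq : IsDecreasingOnD q) (α : ℝ) {ψ : Fk L}
    (h : proj q (dress L α ψ) = 0) : proj q ψ = 0 := by
  have h1 : proj q (undress L α (proj q (dress L α ψ))) = proj q ψ := by
    have h2 : proj q * undress L α * proj q * dress L α = proj q := by
      rw [hq.lowers_undress, mul_assoc, undress_mul_dress, mul_one]
    exact LinearMap.congr_fun h2 ψ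
  rw [← h1, h, map_zero, map_zero]

end IsDecreasingOnD

/-- Every state without doubly occupied D-sites is the projection of a dressed state of the same
kind. -/
theorem projD_dress_projD_undress (α : ℝ) {Ψ : Fk L} (hΨ : projD L Ψ = Ψ) :
    projD L (dress L α (projD L (undress L α Ψ))) = Ψ := by
  have h2 : projD L * dress L α * projD L * undress L α = projD L := by
    rw [projD_eq, isDecreasingOnD_noDouble.lowers_dress, mul_assoc, dress_mul_undress, mul_one]
  exact (LinearMap.congr_fun h2 Ψ).trans hΨ

end Dressing

/-! ### Amplitudes of undressed zero-energy states -/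

section ReducedStates

variable {L : ℕ} [NeZero L]

/-- The equations satisfied by an undressed zero-energy state, with `z = α + β`. The equation of a
D-site holds for the amplitudes on the configurations in which the mode `(x, -σ)` is empty. -/
structure IsReduced (z : ℂ) (χ : Fk L) : Prop where
  noDouble : ∀ S, χ S ≠ 0 → NoDouble S
  bond : ∀ u σ, star (c (.inr u) (!σ)) (c (.inr u) σ χ) = 0
  site : ∀ x σ T, NoDouble T → (.inl x, !σ) ∉ T →
    (∑ v ∈ nbrs x, phase v • star (c (.inr v) (!σ)))
      ((c (.inl x) σ + z • ∑ u ∈ nbrs x, c (.inr u) σ) χ) T = 0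

theorem c_apply (i : Site L) (σ : Spin) (ψ : Fk L) (S : Finset (Mode L)) :
    c i σ ψ S = if (i, σ) ∈ S then 0 else jwSign (i, σ) S * ψ (insert (i, σ) S) := rfl

theorem star_c_apply (i : Site L) (σ : Spin) (ψ : Fk L) (S : Finset (Mode L)) :
    star (c i σ) ψ S =
      if (i, σ) ∈ S then jwSign (i, σ) (S.erase (i, σ)) * ψ (S.erase (i, σ)) else 0 :=
  star_annih_apply _ _ _

namespace IsReduced

variable {z : ℂ} {χ : Fk L}

/-- The P-sites are either empty or doubly occupied. -/
theorem paired (h : IsReduced z χ) {S : Finset (Mode L)} (hS : χ S ≠ 0) {u : PSite L} {σ : Spin}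
    (hu : (.inr u, σ) ∈ S) : (.inr u, !σ) ∈ S := by
  by_contra hu'
  have h1 := congrArg (fun ψ : Fk L => ψ (insert (.inr u, !σ) (S.erase (.inr u, σ)))) (h.bond u σ)
  have h2 : (insert (.inr u, !σ) (S.erase (.inr u, σ)) : Finset (Mode L)).erase (.inr u, !σ) =
      S.erase (.inr u, σ) := Finset.erase_insert (by simp [hu'])
  simp [star_c_apply, c_apply, h2, Finset.insert_erase hu, jwSign_ne_zero, hS] at h1

theorem paired_iff (h : IsReduced z χ) {S : Finset (Mode L)} (hS : χ S ≠ 0) (u : PSite L)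
    (σ τ : Spin) : (.inr u, σ) ∈ S ↔ (.inr u, τ) ∈ S := by
  have h1 := fun σ => h.paired hS (u := u) (σ := σ)
  have h2 := h1 true
  have h3 := h1 false
  cases σ <;> cases τ <;> simp_all <;> tauto

/-- All bonds that end in an occupied D-site are doubly occupied. -/
theorem mem_of_occupied (h : IsReduced z χ) {S : Finset (Mode L)} (hS : χ S ≠ 0) {x : DSite L}
    {σ : Spin} (hx : (.inl x, σ) ∈ S) {v : PSite L} (hv : v ∈ nbrs x) (τ : Spin) :
    (.inr v, τ) ∈ S := by
  by_contra hvτ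
  have hv' : ∀ τ, (.inr v, τ) ∉ S := fun τ' h' => hvτ ((h.paired_iff hS v _ _).mp h')
  have hND := h.noDouble S hS
  -- At this configuration the equation of `x` reduces to the term in `χ S`: in all other terms some
  -- P-site is singly occupied.
  set T : Finset (Mode L) := insert (.inr v, !σ) (S.erase (.inl x, σ)) with hT
  have hTv : T.erase (.inr v, !σ) = S.erase (.inl x, σ) := Finset.erase_insert (by simp [hv'])
  have h1 := h.site x σ T ((noDouble_insert_inr _ _ _).mpr (hND.mono (Finset.erase_subset _ _)))
    (by simp [hT, hND.notMem_flip hx])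
  rw [LinearMap.sum_apply, WithLp.ofLp_sum, Finset.sum_apply,
    Finset.sum_eq_single_of_mem v hv] at h1
  · rw [LinearMap.smul_apply, PiLp.smul_apply, star_c_apply, if_pos (Finset.mem_insert_self _ _),
      hTv, LinearMap.add_apply, PiLp.add_apply, c_apply, if_neg (by simp),
      Finset.insert_erase hx, LinearMap.smul_apply, LinearMap.sum_apply, PiLp.smul_apply,
      WithLp.ofLp_sum, Finset.sum_apply, Finset.sum_eq_zero] at h1
    · simp [phase_ne_zero, jwSign_ne_zero, hS] at h1
    · intro w _
      rw [c_apply]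
      split_ifs with hw
      · rfl
      · have hw' : (.inr w, σ) ∉ S := by simpa using hw
        have hw2 : (.inr w, !σ) ∉ S := fun h' => hw' ((h.paired_iff hS w _ _).mp h')
        suffices χ (insert (.inr w, σ) (S.erase (.inl x, σ))) = 0 by rw [this, mul_zero]
        by_contra hne
        have := h.paired hne (Finset.mem_insert_self _ _)
        simp [hw2] at this
  · intro w _ hwv
    rw [LinearMap.smul_apply, PiLp.smul_apply, star_c_apply]
    split_ifs with hw
    · have hwS : (.inr w, !σ) ∈ S := by simpa [hT, hwv] using hw
      have hwS' : (.inr w, σ) ∈ S := (h.paired_iff hS w _ _).mp hwS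
      have hvT : (.inr v, !σ) ∈ T.erase (.inr w, !σ) := by simp [hT, Ne.symm hwv]
      have hvT' : (.inr v, σ) ∉ T.erase (.inr w, !σ) := by simp [hT, hv']
      rw [LinearMap.add_apply, PiLp.add_apply, c_apply, if_neg (by simp [hT]),
        LinearMap.smul_apply, LinearMap.sum_apply, PiLp.smul_apply, WithLp.ofLp_sum,
        Finset.sum_apply, Finset.sum_eq_zero]
      · suffices χ (insert (.inl x, σ) (T.erase (.inr w, !σ))) = 0 by simp [this]
        by_contra hne
        have := h.paired hne (Finset.mem_insert_of_mem hvT)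
        simp [hvT'] at this
      · intro w' _
        rw [c_apply]
        split_ifs with hw'
        · rfl
        suffices χ (insert (.inr w', σ) (T.erase (.inr w, !σ))) = 0 by rw [this, mul_zero]
        by_contra hne
        have h3 := h.paired hne (Finset.mem_insert_of_mem hvT)
        have h4 : v = w' := by simpa [hT, hv'] using h3
        subst h4
        have h5 : (.inr w, σ) ∈ insert (.inr v, σ) (T.erase (.inr w, !σ)) := by
          simp [hT, hwS']
        have h6 := h.paired hne h5
        simp at h6
    · simp

/-- The configuration obtained by moving the pair at the P-site `u` to the P-site `v`. -/
def movePair (u v : PSite L) (S : Finset (Mode L)) : Finset (Mode L) :=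
  insert (.inr v, true) (insert (.inr v, false) ((S.erase (.inr u, true)).erase (.inr u, false)))

/-- Pairs can be moved between two bonds that meet in an empty D-site: the amplitudes before and
after the move are proportional. -/
theorem movePair_ne_zero (h : IsReduced z χ) (hz : z ≠ 0) {S : Finset (Mode L)} (hS : χ S ≠ 0)
    {x : DSite L} (hx : ∀ σ, (.inl x, σ) ∉ S) {u v : PSite L} (hu : u ∈ nbrs x) (hv : v ∈ nbrs x)
    (huS : ∀ σ, (.inr u, σ) ∈ S) (hvS : ∀ σ, (.inr v, σ) ∉ S) : χ (movePair u v S) ≠ 0 := by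
  intro h0
  have huv : u ≠ v := by
    rintro rfl
    exact hvS true (huS true)
  -- At this configuration, in which `u` and `v` are both singly occupied, the equation of `x`
  -- relates the amplitudes before and after the move.
  set T : Finset (Mode L) := insert (.inr v, false) (S.erase (.inr u, true)) with hT
  have hTv : T.erase (.inr v, false) = S.erase (.inr u, true) :=
    Finset.erase_insert (by simp [hvS])
  have h1 := h.site x true T
    ((noDouble_insert_inr _ _ _).mpr ((h.noDouble S hS).mono (Finset.erase_subset _ _)))
    (by simp [hT, hx])
  -- An electron with spin up is added at `w'` after one with spin down has been removed at `w`;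
  -- only the choices that restore the pairing contribute.
  have key : ∀ w w' : PSite L, (.inr w, false) ∈ T → (.inr w', true) ∉ T → (w ≠ v ∨ w' ≠ u) →
      χ (insert (.inr w', true) (T.erase (.inr w, false))) = 0 := by
    intro w w' hw hw' hne
    by_contra hR
    by_cases hwv : w = v
    · subst hwv
      have h2 := h.paired hR (u := u) (σ := false) (by simp [hTv, huS])
      have : u = w' := by simpa [hTv] using h2
      simp [this] at hne
    · have h2 := h.paired hR (u := v) (σ := false) (by simp [hT, Ne.symm hwv])
      have hvw' : v = w' := by simpa [hT, hvS] using h2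
      subst hvw'
      by_cases hwu : w = u
      · subst hwu
        apply hR
        rw [← h0, movePair, hT, Finset.erase_insert_of_ne (by simp [Ne.symm huv])]
      · have h3 := h.paired hR (u := u) (σ := false) (by simp [hT, Ne.symm hwu, huS])
        simp [hT, huv] at h3
  have expand : ∀ w, ((.inr w, false) : Mode L) ∈ T → (c (.inl x) true +
      z • ∑ u ∈ nbrs x, c (.inr u) true) χ (T.erase (.inr w, false)) =
      z * ∑ w' ∈ nbrs x, c (.inr w') true χ (T.erase (.inr w, false)) := by
    intro w hw
    rw [LinearMap.add_apply, PiLp.add_apply, LinearMap.smul_apply, LinearMap.sum_apply,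
      PiLp.smul_apply, WithLp.ofLp_sum, Finset.sum_apply, c_apply, if_neg (by simp [hT, hx]),
      smul_eq_mul]
    suffices χ (insert (.inl x, true) (T.erase (.inr w, false))) = 0 by simp [this]
    by_contra hne
    by_cases hwv : w = v
    · subst hwv
      have h2 := h.paired hne (u := u) (σ := false) (by simp [hTv, huS])
      simp [hTv] at h2
    · have h2 := h.paired hne (u := v) (σ := false) (by simp [hT, Ne.symm hwv])
      simp [hT, hvS] at h2
  rw [LinearMap.sum_apply, WithLp.ofLp_sum, Finset.sum_apply,
    Finset.sum_eq_single_of_mem v hv] at h1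
  · have hvT : ((.inr v, false) : Mode L) ∈ T := Finset.mem_insert_self _ _
    rw [LinearMap.smul_apply, PiLp.smul_apply, Bool.not_true, star_c_apply, if_pos hvT,
      expand v hvT, Finset.sum_eq_single_of_mem u hu, hTv, c_apply, if_neg (by simp),
      Finset.insert_erase (huS true)] at h1
    · simp [phase_ne_zero, jwSign_ne_zero, hS, hz] at h1
    · intro w' _ hw'
      rw [c_apply]
      split_ifs with hm
      · rfl
      · rw [key v w' hvT (by simpa using hm) (Or.inr hw'), mul_zero]
  · intro w _ hwv
    rw [LinearMap.smul_apply, PiLp.smul_apply, Bool.not_true, star_c_apply]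
    split_ifs with hw
    · rw [expand w hw, Finset.sum_eq_zero]
      · simp
      · intro w' _
        rw [c_apply]
        split_ifs with hm
        · rfl
        · rw [key w w' hw (by simpa using hm) (Or.inl hwv), mul_zero]
    · simp

end IsReduced

end ReducedStates

/-! ### Moving holes and pairs over the lattice -/

section Connectivity

variable {L : ℕ} [NeZero L]

/-- The graph of P-sites, in which two P-sites are adjacent if they are bonds with a common
end-point, is connected. -/
theorem forall_mem_of_closed {C : Set (PSite L)} (hne : C.Nonempty)
    (hC : ∀ x : DSite L, ∀ v ∈ nbrs x, v ∈ C → ∀ u ∈ nbrs x, u ∈ C) (u : PSite L) : u ∈ C := by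
  have hstep : ∀ (x : DSite L) (l : Fin 2), (∀ u ∈ nbrs x, u ∈ C) →
      ∀ u ∈ nbrs (x + δ L l), u ∈ C := by
    intro x l h
    exact hC _ (x, l) (by simp [mem_nbrs, endpoints]) (h _ (by simp [mem_nbrs, endpoints]))
  have hsteps : ∀ (k : ℕ) (l : Fin 2) (x : DSite L), (∀ u ∈ nbrs x, u ∈ C) →
      ∀ u ∈ nbrs (x + k • δ L l), u ∈ C := by
    intro k l x h
    induction k with
    | zero => simpa using h
    | succ k ih =>
      rw [succ_nsmul, ← add_assoc]
      exact hstep _ l ih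
  obtain ⟨v, hv⟩ := hne
  have h0 : ∀ u ∈ nbrs v.1, u ∈ C := hC v.1 v (by simp [mem_nbrs, endpoints]) hv
  have h1 := hsteps (u.1 1 - v.1 1).val 1 _ (hsteps (u.1 0 - v.1 0).val 0 _ h0)
  have h2 : v.1 + (u.1 0 - v.1 0).val • δ L 0 + (u.1 1 - v.1 1).val • δ L 1 = u.1 := by
    funext j
    fin_cases j <;> simp [δ, -ZMod.natCast_val, ZMod.natCast_zmod_val]
  rw [h2] at h1
  exact h1 u (by simp [mem_nbrs, endpoints])

/-- The configuration in which exactly the P-sites in `B` are doubly occupied, and all other sites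
are empty. -/
def pairConfig (B : Finset (PSite L)) : Finset (Mode L) :=
  Finset.univ.filter fun q => ∃ u ∈ B, q.1 = .inr u

theorem inr_mem_pairConfig {B : Finset (PSite L)} {u : PSite L} {σ : Spin} :
    (.inr u, σ) ∈ pairConfig B ↔ u ∈ B := by
  simp [pairConfig]

theorem inl_notMem_pairConfig {B : Finset (PSite L)} {x : DSite L} {σ : Spin} :
    (.inl x, σ) ∉ pairConfig B := by
  simp [pairConfig]

theorem card_pairConfig (B : Finset (PSite L)) : (pairConfig B).card = 2 * B.card := by
  have : pairConfig B = (B ×ˢ (Finset.univ : Finset Spin)).image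
      fun q => ((.inr q.1, q.2) : Mode L) := by
    ext ⟨i, σ⟩
    rcases i with x | u <;> simp [pairConfig]
  rw [this, Finset.card_image_of_injective, Finset.card_product, Finset.card_univ,
    Fintype.card_bool, mul_comm]
  rintro ⟨u, σ⟩ ⟨v, τ⟩ h
  simpa using h

namespace IsReduced

variable {z : ℂ} {χ : Fk L}

/-- A hole in the P-sites could be moved next to an occupied D-site, which is impossible. -/
theorem inl_notMem (h : IsReduced z χ) (hz : z ≠ 0) {N : ℕ}
    (hN : N ≤ 2 * Fintype.card (PSite L)) (hχ : ∀ S, χ S ≠ 0 → S.card = N)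
    {S : Finset (Mode L)} (hS : χ S ≠ 0) (x : DSite L) (σ : Spin) : (.inl x, σ) ∉ S := by
  intro hx
  -- The P-sites that are empty in some configuration with nonzero amplitude and an electron in the
  -- mode `(x, σ)` form a set that is closed under adjacency.
  have hall := forall_mem_of_closed
    (C := {v | ∃ S, χ S ≠ 0 ∧ (.inl x, σ) ∈ S ∧ (.inr v, true) ∉ S}) ?_ ?_ (x, 0)
  · obtain ⟨S', hS', hx', hv⟩ := hall
    exact hv (h.mem_of_occupied hS' hx' (by simp [mem_nbrs, endpoints]) true)
  · by_contra hempty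
    have hfull : ∀ v σ, (.inr v, σ) ∈ S := by
      intro v τ
      rw [h.paired_iff hS v τ true]
      by_contra hv
      exact hempty ⟨v, S, hS, hx, hv⟩
    have hlt : (pairConfig (Finset.univ : Finset (PSite L))) ⊂ S := by
      refine ⟨?_, fun hsub => inl_notMem_pairConfig (hsub hx)⟩
      rintro ⟨i, τ⟩ hq
      rcases i with y | u
      · exact absurd hq inl_notMem_pairConfig
      · exact hfull u τ
    have := Finset.card_lt_card hlt
    rw [card_pairConfig, hχ S hS, Finset.card_univ] at this
    omega
  · rintro y v hv ⟨S', hS', hx', hvS⟩ u hu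
    by_cases huS : (.inr u, true) ∈ S'
    · have hy : ∀ τ, (.inl y, τ) ∉ S' := fun τ hy =>
        hvS (h.mem_of_occupied hS' hy hv true)
      have huv : u ≠ v := fun e => hvS (e ▸ huS)
      refine ⟨movePair u v S', h.movePair_ne_zero hz hS' hy hu hv
        (fun τ => (h.paired_iff hS' u _ _).mp huS)
        (fun τ h' => hvS ((h.paired_iff hS' v _ _).mp h')), ?_, ?_⟩
      · simp [movePair, hx']
      · simp [movePair, huv]
    · exact ⟨S', hS', hx', huS⟩

theorem eq_pairConfig (h : IsReduced z χ) (hz : z ≠ 0) {N : ℕ}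
    (hN : N ≤ 2 * Fintype.card (PSite L)) (hχ : ∀ S, χ S ≠ 0 → S.card = N)
    {S : Finset (Mode L)} (hS : χ S ≠ 0) :
    S = pairConfig (Finset.univ.filter fun u => (.inr u, true) ∈ S) := by
  ext ⟨i, σ⟩
  rcases i with x | u
  · simp [inl_notMem_pairConfig, h.inl_notMem hz hN hχ hS]
  · rw [inr_mem_pairConfig, h.paired_iff hS u σ true]
    simp

theorem pairConfig_move_ne_zero (h : IsReduced z χ) (hz : z ≠ 0) (u v : PSite L)
    (B : Finset (PSite L)) (hu : u ∈ B) (hv : v ∉ B) (hB : χ (pairConfig B) ≠ 0) :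
    χ (pairConfig (insert v (B.erase u))) ≠ 0 := by
  revert v B
  suffices H : ∀ v, v ∈ {v | ∀ B : Finset (PSite L), u ∈ B → v ∉ B → χ (pairConfig B) ≠ 0 →
      χ (pairConfig (insert v (B.erase u))) ≠ 0} from fun v B hu hv hB => H v B hu hv hB
  refine forall_mem_of_closed ⟨u, fun B hu hu' => absurd hu hu'⟩ ?_
  intro y v hv hC w hw B huB hwB hB
  have hstep : ∀ B' : Finset (PSite L), v ∈ B' → w ∉ B' → χ (pairConfig B') ≠ 0 →
      χ (pairConfig (insert w (B'.erase v))) ≠ 0 := by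
    intro B' hvB' hwB' hB'
    have hvw : v ≠ w := fun e => hwB' (e ▸ hvB')
    have := h.movePair_ne_zero hz hB' (x := y) (fun _ => inl_notMem_pairConfig) hv hw
      (fun _ => inr_mem_pairConfig.mpr hvB') (fun _ h' => hwB' (inr_mem_pairConfig.mp h'))
    convert this using 2
    ext ⟨i, σ⟩
    rcases i with x | t
    · simp [movePair, inl_notMem_pairConfig]
    · cases σ <;> simp [movePair, inr_mem_pairConfig]
  -- If `v` is occupied, its pair moves on to `w` first, and the pair of `u` takes its place.
  by_cases hvB : v ∈ B
  · rcases eq_or_ne u v with rfl | huv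
    · exact hstep B huB hwB hB
    have hvw : v ≠ w := fun e => hwB (e ▸ hvB)
    have huw : u ≠ w := fun e => hwB (e ▸ huB)
    have h1 := hstep B hvB hwB hB
    have h2 := hC (insert w (B.erase v)) (by simp [huv, huB]) (by simp [hvw]) h1
    have e : insert v ((insert w (B.erase v)).erase u) = insert w (B.erase u) := by
      ext t
      simp only [Finset.mem_insert, Finset.mem_erase]
      grind
    rwa [e] at h2
  · have huv : u ≠ v := fun e => hvB (e ▸ huB)
    rcases eq_or_ne v w with rfl | hvw
    · exact hC B huB hwB hB
    have h1 := hC B huB hvB hB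
    have h2 := hstep (insert v (B.erase u)) (by simp) (by simp [hvw.symm, hwB]) h1
    rwa [Finset.erase_insert (by simp [hvB])] at h2

theorem pairConfig_ne_zero_of_card_eq (h : IsReduced z χ) (hz : z ≠ 0) (k : ℕ) :
    ∀ B B' : Finset (PSite L), (B \ B').card = k → B.card = B'.card →
      χ (pairConfig B) ≠ 0 → χ (pairConfig B') ≠ 0 := by
  induction k with
  | zero =>
    intro B B' hk hc hB
    rw [Finset.card_eq_zero, Finset.sdiff_eq_empty_iff_subset] at hk
    rwa [← Finset.eq_of_subset_of_card_le hk hc.ge]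
  | succ k ih =>
    intro B B' hk hc hB
    obtain ⟨u, hu⟩ : (B \ B').Nonempty := by
      rw [← Finset.card_pos]
      omega
    obtain ⟨v, hv⟩ : (B' \ B).Nonempty := by
      rw [← Finset.card_pos, Finset.card_sdiff_comm hc.symm]
      omega
    rw [Finset.mem_sdiff] at hu hv
    refine ih (insert v (B.erase u)) B' ?_ ?_ (h.pairConfig_move_ne_zero hz u v B hu.1 hv.2 hB)
    · have : insert v (B.erase u) \ B' = (B \ B').erase u := by
        ext t
        simp only [Finset.mem_sdiff, Finset.mem_insert, Finset.mem_erase]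
        grind
      rw [this, Finset.card_erase_of_mem (by simp [hu]), hk, Nat.add_sub_cancel]
    · rw [Finset.card_insert_of_notMem (by simp [hv.2]), Finset.card_erase_of_mem hu.1, ← hc]
      have := Finset.card_pos.mpr ⟨u, hu.1⟩
      omega

/-- A nonzero undressed zero-energy state consists of pairs on the P-sites, and all pair
configurations occur in it. -/
theorem even_and_pairConfig_ne_zero (h : IsReduced z χ) (hz : z ≠ 0) {N : ℕ}
    (hN : N ≤ 2 * Fintype.card (PSite L)) (hχ : ∀ S, χ S ≠ 0 → S.card = N) (h0 : χ ≠ 0) :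
    Even N ∧ ∀ B : Finset (PSite L), 2 * B.card = N → χ (pairConfig B) ≠ 0 := by
  obtain ⟨S, hS⟩ : ∃ S, χ S ≠ 0 := by
    by_contra! hall
    exact h0 (by ext S; simpa using hall S)
  have hSB := h.eq_pairConfig hz hN hχ hS
  set B₀ : Finset (PSite L) := Finset.univ.filter fun u => (.inr u, true) ∈ S
  have hc : 2 * B₀.card = N := by rw [← card_pairConfig, ← hSB, hχ S hS]
  refine ⟨⟨B₀.card, by omega⟩, fun B hB => ?_⟩
  have hB₀ : χ (pairConfig B₀) ≠ 0 := fun e => hS ((congrArg χ.ofLp hSB).trans e)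
  exact h.pairConfig_ne_zero_of_card_eq hz _ B₀ B rfl (by omega) hB₀

end IsReduced

end Connectivity

/-! ### Undressing zero-energy states -/

section BlockedSite

variable {L : ℕ} [NeZero L]

/-- No D-site is doubly occupied, and the mode `(x, σ)` is empty. -/
def NoDoubleEmptyAt (x : DSite L) (σ : Spin) (S : Finset (Mode L)) : Prop :=
  NoDouble S ∧ (.inl x, σ) ∉ S

omit [NeZero L] in
theorem isDecreasingOnD_noDoubleEmptyAt (x : DSite L) (σ : Spin) :
    IsDecreasingOnD (NoDoubleEmptyAt x σ) where
  erase S m h := ⟨h.1.mono (Finset.erase_subset _ _), fun h' => h.2 (Finset.mem_of_mem_erase h')⟩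
  insert_inr S u τ := by simp [NoDoubleEmptyAt, noDouble_insert_inr]

theorem proj_noDoubleEmptyAt (x : DSite L) (σ : Spin) :
    proj (NoDoubleEmptyAt x σ) = projD L * (1 - n (.inl x) σ) := by
  refine LinearMap.ext fun ψ => ?_
  ext S
  by_cases h1 : NoDouble S <;> by_cases h2 : (.inl x, σ) ∈ S <;>
    simp [projD_eq, proj_apply, NoDoubleEmptyAt, n_apply, h1, h2]

theorem proj_noDoubleEmptyAt_mul_projD (x : DSite L) (σ : Spin) :
    proj (NoDoubleEmptyAt x σ) * projD L = proj (NoDoubleEmptyAt x σ) := by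
  rw [projD_eq, proj_mul_proj]
  congr 1
  funext S
  simp only [NoDoubleEmptyAt, eq_iff_iff]
  tauto

/-- Removing an electron from `x` between the projections leaves the site empty. -/
theorem projD_mul_c_inl_mul_projD (x : DSite L) (σ : Spin) :
    projD L * c (.inl x) σ * projD L = proj (NoDoubleEmptyAt x (!σ)) * c (.inl x) σ := by
  refine LinearMap.ext fun ψ => ?_
  ext S
  by_cases hx : (.inl x, σ) ∈ S
  · simp [projD_eq, proj_apply, c_apply, hx]
  by_cases h2 : (.inl x, !σ) ∈ S
  · simp [projD_eq, proj_apply, NoDoubleEmptyAt, c_apply, hx, h2, not_noDouble_insert_inl h2]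
  by_cases h1 : NoDouble S
  · simp [projD_eq, proj_apply, NoDoubleEmptyAt, c_apply, hx, h1, h2, noDouble_insert_inl h2]
  · simp [projD_eq, proj_apply, NoDoubleEmptyAt, h1]

/-- If the mode `(x, -σ)` is empty afterwards, then the removal of an electron of spin `σ` cannot
have destroyed a double occupancy. -/
theorem proj_noDoubleEmptyAt_mul_c_inl (x : DSite L) (σ : Spin) :
    proj (NoDoubleEmptyAt x (!σ)) * c (.inl x) σ * projD L =
      proj (NoDoubleEmptyAt x (!σ)) * c (.inl x) σ := by
  nth_rewrite 1 [← proj_noDoubleEmptyAt_mul_projD]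
  rw [mul_assoc, mul_assoc, ← mul_assoc (projD L), projD_mul_c_inl_mul_projD, ← mul_assoc,
    proj_mul_self]

theorem proj_noDoubleEmptyAt_mul_b (β : ℝ) (x : DSite L) (σ : Spin) :
    proj (NoDoubleEmptyAt x (!σ)) * b β x σ * projD L =
      proj (NoDoubleEmptyAt x (!σ)) * b β x σ := by
  have h : ∀ u, proj (NoDoubleEmptyAt x (!σ)) * c (.inr u) σ * projD L =
      proj (NoDoubleEmptyAt x (!σ)) * c (.inr u) σ := by
    intro u
    rw [mul_assoc, ← (commute_projD_c_inr u σ).eq, ← mul_assoc, proj_noDoubleEmptyAt_mul_projD]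
  rw [b, mul_add, add_mul, proj_noDoubleEmptyAt_mul_c_inl, mul_smul_comm, smul_mul_assoc,
    Finset.mul_sum, Finset.sum_mul, Finset.sum_congr rfl fun u _ => h u]

theorem star_d (α : ℝ) (x : DSite L) (σ : Spin) :
    star (d α x σ) = ∑ u ∈ nbrs x, phase u • star (a α u σ) := by
  simp only [d_eq_sum, star_sum, star_smul, star_phase]

theorem star_d_mul_dress (α : ℝ) (x : DSite L) (σ : Spin) : star (d α x σ) * dress L α =
    dress L α * ∑ u ∈ nbrs x, phase u • star (c (.inr u) σ) := by
  simp only [star_d, Finset.sum_mul, Finset.mul_sum, smul_mul_assoc, mul_smul_comm,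
    star_a_mul_dress]

theorem b_mul_dress (α β : ℝ) (x : DSite L) (σ : Spin) : b β x σ * dress L α =
    dress L α * (c (.inl x) σ + ((α : ℂ) + β) • ∑ u ∈ nbrs x, c (.inr u) σ) := by
  rw [b, add_mul, c_inl_mul_dress, smul_mul_assoc, Finset.sum_mul,
    Finset.sum_congr rfl fun u _ => c_inr_mul_dress α u σ, ← Finset.mul_sum, ← mul_smul_comm,
    ← mul_add, add_smul, add_assoc]

/-- Undressing turns zero-energy states into solutions of the reduced equations. -/
theorem isReduced_undress {p : Params} {Ψ : Fk L} (hP : projD L Ψ = Ψ)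
    (hsite : ∀ x σ, siteOp p x σ Ψ = 0) (hbond : ∀ u σ, bondOp p u σ Ψ = 0) :
    IsReduced ((p.α : ℂ) + p.β) (projD L (undress L p.α Ψ)) := by
  set χ := projD L (undress L p.α Ψ) with hχ
  have hPχ : projD L χ = χ := LinearMap.congr_fun projD_mul_self (undress L p.α Ψ)
  have hΨ : Ψ = projD L (dress L p.α χ) := (projD_dress_projD_undress p.α hP).symm
  refine ⟨?_, ?_, ?_⟩
  · rwa [projD_eq, proj_eq_self_iff] at hPχ
  · intro u σ
    have h1 : bondOp p u σ * projD L * dress L p.α =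
        projD L * dress L p.α * (star (c (.inr u) (!σ)) * c (.inr u) σ) := by
      calc bondOp p u σ * projD L * dress L p.α
          = projD L * star (a p.α u (!σ)) * (c (.inr u) σ * projD L) * dress L p.α := by
            rw [bondOp, mul_assoc (_ * _) (projD L) (projD L), projD_mul_self]
            simp only [mul_assoc]
        _ = projD L * star (a p.α u (!σ)) * projD L * (c (.inr u) σ * dress L p.α) := by
            rw [← (commute_projD_c_inr u σ).eq]
            simp only [mul_assoc]
        _ = projD L * (star (a p.α u (!σ)) * dress L p.α) * c (.inr u) σ := by
            rw [a_eq_lin, lowers_projD_star_lin, c_inr_mul_dress]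
            simp only [mul_assoc]
        _ = _ := by
            rw [star_a_mul_dress]
            simp only [mul_assoc]
    have h2 : projD L (dress L p.α (star (c (.inr u) (!σ)) (c (.inr u) σ χ))) = 0 := by
      have := LinearMap.congr_fun h1 χ
      simp only [Module.End.mul_apply] at this
      rw [← this, ← hΨ, hbond]
    rw [projD_eq] at h2
    have h3 := isDecreasingOnD_noDouble.proj_eq_zero_of_proj_dress p.α h2
    have h4 : proj NoDouble * (star (c (.inr u) (!σ)) * c (.inr u) σ) =
        (star (c (.inr u) (!σ)) * c (.inr u) σ) * proj NoDouble :=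
      ((isDecreasingOnD_noDouble.commute_star_c_inr u (!σ)).mul_right
        (isDecreasingOnD_noDouble.commute_c_inr u σ)).eq
    have h5 := LinearMap.congr_fun h4 χ
    simp only [Module.End.mul_apply] at h5
    rwa [h3, ← projD_eq, hPχ, eq_comm] at h5
  · intro x σ T hT hxT
    -- Restricted to configurations with the mode `(x, -σ)` empty, the projection to the right of
    -- `b_x` is redundant, and the dressing can be commuted through.
    set R : Op L := proj (NoDoubleEmptyAt x (!σ)) with hR
    set X : Op L := (∑ v ∈ nbrs x, phase v • star (c (.inr v) (!σ))) *
      (c (.inl x) σ + ((p.α : ℂ) + p.β) • ∑ u ∈ nbrs x, c (.inr u) σ) with hX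
    have hlow : R * star (d p.α x (!σ)) * R = R * star (d p.α x (!σ)) := by
      rw [d_eq_lin]
      exact (isDecreasingOnD_noDoubleEmptyAt x (!σ)).lowers_star_lin _ _
    have h1 : R * siteOp p x σ * projD L * dress L p.α = R * dress L p.α * X := by
      calc R * siteOp p x σ * projD L * dress L p.α
          = (R * projD L) * star (d p.α x (!σ)) * b p.β x σ * (projD L * projD L) *
              dress L p.α := by
            rw [siteOp]
            simp only [mul_assoc]
        _ = R * star (d p.α x (!σ)) * (R * b p.β x σ * projD L) * dress L p.α := by
            rw [hR, proj_noDoubleEmptyAt_mul_projD, ← hR, projD_mul_self]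
            nth_rewrite 1 [← hlow]
            simp only [mul_assoc]
        _ = R * star (d p.α x (!σ)) * (b p.β x σ * dress L p.α) := by
            rw [hR, proj_noDoubleEmptyAt_mul_b, ← hR, ← mul_assoc, hlow]
            simp only [mul_assoc]
        _ = R * (star (d p.α x (!σ)) * dress L p.α) *
              (c (.inl x) σ + ((p.α : ℂ) + p.β) • ∑ u ∈ nbrs x, c (.inr u) σ) := by
            rw [b_mul_dress p.α p.β]
            simp only [mul_assoc]
        _ = _ := by
            rw [star_d_mul_dress, hX]
            simp only [mul_assoc]
    have h2 : R (dress L p.α (X χ)) = 0 := by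
      have := LinearMap.congr_fun h1 χ
      simp only [Module.End.mul_apply] at this
      rw [← this, ← hΨ, hsite, map_zero]
    have h3 := (isDecreasingOnD_noDoubleEmptyAt x (!σ)).proj_eq_zero_of_proj_dress p.α h2
    have h4 := congrArg (fun ψ : Fk L => ψ T) h3
    simp only [proj_apply, PiLp.zero_apply] at h4
    rwa [if_pos (show NoDoubleEmptyAt x (!σ) T from ⟨hT, hxT⟩)] at h4

end BlockedSite

/-! ### The pair condensate -/

section PairState

variable {L : ℕ} [NeZero L]

theorem zetaDag_eq (α : ℝ) : zetaDag L α =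
    ∑ u : PSite L, phase u • (star (a α u true) * star (a α u false)) := by
  simp only [zetaDag, exp_two_Qdot]
  rfl

variable (L) in
/-- The undressed pair creation operator, with pairs on the P-sites. -/
noncomputable def pairDag : Op L :=
  ∑ u : PSite L, phase u • (star (c (.inr u) true) * star (c (.inr u) false))

theorem zetaDag_mul_dress (α : ℝ) : zetaDag L α * dress L α = dress L α * pairDag L := by
  simp only [zetaDag_eq, pairDag, Finset.sum_mul, Finset.mul_sum, smul_mul_assoc, mul_smul_comm]
  refine Finset.sum_congr rfl fun u _ => ?_
  rw [mul_assoc, star_a_mul_dress, ← mul_assoc, star_a_mul_dress, mul_assoc]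

theorem zetaDag_pow_mul_dress (α : ℝ) (M : ℕ) :
    zetaDag L α ^ M * dress L α = dress L α * pairDag L ^ M := by
  induction M with
  | zero => simp
  | succ M ih => rw [pow_succ, mul_assoc, zetaDag_mul_dress, ← mul_assoc, ih, mul_assoc, ← pow_succ]

theorem zetaDag_pow_vacuum (α : ℝ) (M : ℕ) :
    (zetaDag L α ^ M) vacuum = dress L α ((pairDag L ^ M) vacuum) := by
  have := LinearMap.congr_fun (zetaDag_pow_mul_dress α M) (vacuum : Fk L)
  simpa only [Module.End.mul_apply, dress_vacuum] using this

theorem commute_projD_pairDag : Commute (projD L) (pairDag L) := by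
  rw [projD_eq]
  exact Commute.sum_right _ _ _ fun u _ =>
    ((isDecreasingOnD_noDouble.commute_star_c_inr u _).mul_right
      (isDecreasingOnD_noDouble.commute_star_c_inr u _)).smul_right _

theorem projD_vacuum : projD L vacuum = vacuum := by
  rw [projD_eq]
  exact proj_vacuum (by simp [NoDouble])

theorem projD_pairDag_pow_vacuum (M : ℕ) :
    projD L ((pairDag L ^ M) vacuum) = (pairDag L ^ M) vacuum := by
  have := LinearMap.congr_fun (commute_projD_pairDag.pow_right M).eq (vacuum : Fk L)
  simpa only [Module.End.mul_apply, projD_vacuum] using this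

variable (L) in
/-- The third component of the pseudospin, up to a factor: the commutator of the pair annihilation
and the pair creation operators. -/
noncomputable def pairZ : Op L :=
  ∑ u : PSite L, (1 - n (.inr u) true - n (.inr u) false)

theorem star_pairDag : star (pairDag L) =
    ∑ u : PSite L, phase u • (c (.inr u) false * c (.inr u) true) := by
  simp only [pairDag, star_sum, star_smul, star_phase, star_mul, star_star]

theorem n_mul_star_c (i j : Site L) (σ τ : Spin) : n i σ * star (c j τ) =
    star (c j τ) * n i σ + if (i, σ) = (j, τ) then star (c j τ) else 0 := by
  have h : star (c i σ) * star (c j τ) = -(star (c j τ) * star (c i σ)) :=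
    star_annih_mul_star_annih _ _
  rw [n, numOf_eq, mul_assoc, c_mul_star_c, mul_sub, ← mul_assoc, h, neg_mul, sub_neg_eq_add,
    mul_assoc, add_comm]
  by_cases hij : (i, σ) = (j, τ)
  · obtain ⟨rfl, rfl⟩ := Prod.mk.inj hij
    simp
  · simp [hij]

theorem star_pair_mul_pair (u v : PSite L) : c (.inr u) false * c (.inr u) true *
    (star (c (.inr v) true) * star (c (.inr v) false)) =
      star (c (.inr v) true) * star (c (.inr v) false) * (c (.inr u) false * c (.inr u) true) +
        if u = v then 1 - n (.inr u) true - n (.inr u) false else 0 := by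
  have hft : c (.inr u) false * star (c (.inr v) true) =
      -(star (c (.inr v) true) * c (.inr u) false) := by
    rw [c_mul_star_c]; simp
  have htf : c (.inr u) true * star (c (.inr v) false) =
      -(star (c (.inr v) false) * c (.inr u) true) := by
    rw [c_mul_star_c]; simp
  have htt : c (.inr u) true * star (c (.inr v) true) =
      (if u = v then 1 else 0) - star (c (.inr v) true) * c (.inr u) true := by
    rw [c_mul_star_c]; simp
  have hff : c (.inr u) false * star (c (.inr v) false) =
      (if u = v then 1 else 0) - star (c (.inr v) false) * c (.inr u) false := by
    rw [c_mul_star_c]; simp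
  calc _ = c (.inr u) false * (c (.inr u) true * star (c (.inr v) true)) *
        star (c (.inr v) false) := by simp only [mul_assoc]
    _ = (if u = v then 1 else 0) * (c (.inr u) false * star (c (.inr v) false)) -
        (c (.inr u) false * star (c (.inr v) true)) *
          (c (.inr u) true * star (c (.inr v) false)) := by
      rw [htt]
      split_ifs <;> simp only [mul_sub, sub_mul, mul_assoc, one_mul, zero_mul, mul_zero]
    _ = (if u = v then 1 else 0) * (c (.inr u) false * star (c (.inr v) false)) -
        star (c (.inr v) true) * (c (.inr u) false * star (c (.inr v) false)) *
          c (.inr u) true := by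
      rw [hft, htf]
      simp only [neg_mul_neg, mul_assoc]
    _ = _ := by
      rw [hff]
      split_ifs with huv
      · subst huv
        simp only [n, numOf_eq, one_mul, mul_sub, sub_mul, mul_one, mul_assoc]
        abel
      · simp only [zero_mul, zero_sub, mul_neg, neg_mul, mul_assoc, add_zero, sub_neg_eq_add,
          neg_zero, zero_add]

theorem star_pairDag_mul_pairDag :
    star (pairDag L) * pairDag L = pairDag L * star (pairDag L) + pairZ L := by
  rw [star_pairDag, pairDag, Finset.sum_mul_sum, Finset.sum_mul_sum]
  simp only [smul_mul_smul_comm, star_pair_mul_pair, smul_add, Finset.sum_add_distrib]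
  refine congrArg₂ (· + ·) ?_ ?_
  · rw [Finset.sum_comm]
    refine Finset.sum_congr rfl fun v _ => Finset.sum_congr rfl fun u _ => ?_
    rw [mul_comm]
  · simp [pairZ, phase_mul_self]

theorem pairZ_mul_pairDag : pairZ L * pairDag L = pairDag L * pairZ L - (2 : ℂ) • pairDag L := by
  have key : ∀ u v : PSite L, (1 - n (.inr u) true - n (.inr u) false) *
      (star (c (.inr v) true) * star (c (.inr v) false)) =
      star (c (.inr v) true) * star (c (.inr v) false) *
        (1 - n (.inr u) true - n (.inr u) false) -
      if u = v then (2 : ℂ) • (star (c (.inr v) true) * star (c (.inr v) false)) else 0 := by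
    intro u v
    have htrue : n (.inr u) true * (star (c (.inr v) true) * star (c (.inr v) false)) =
        star (c (.inr v) true) * star (c (.inr v) false) * n (.inr u) true +
          if u = v then star (c (.inr v) true) * star (c (.inr v) false) else 0 := by
      rw [← mul_assoc, n_mul_star_c, add_mul, mul_assoc, n_mul_star_c, mul_add, ← mul_assoc]
      simp
    have hfalse : n (.inr u) false * (star (c (.inr v) true) * star (c (.inr v) false)) =
        star (c (.inr v) true) * star (c (.inr v) false) * n (.inr u) false +
          if u = v then star (c (.inr v) true) * star (c (.inr v) false) else 0 := by
      rw [← mul_assoc, n_mul_star_c, add_mul, mul_assoc, n_mul_star_c, mul_add, ← mul_assoc]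
      simp
    rw [sub_mul, sub_mul, htrue, hfalse, mul_sub, mul_sub, one_mul, mul_one]
    split_ifs
    · rw [two_smul]
      abel
    · abel
  rw [pairZ, pairDag, Finset.sum_mul_sum, Finset.sum_mul_sum, Finset.smul_sum]
  simp only [mul_smul_comm, smul_mul_assoc, key, smul_sub, Finset.sum_sub_distrib]
  congr 1
  · exact Finset.sum_comm
  · simp only [smul_ite, smul_zero, Finset.sum_ite_eq, Finset.mem_univ, if_true]
    exact Finset.sum_congr rfl fun u _ => smul_comm _ _ _

theorem pairZ_pairDag_pow_vacuum (M : ℕ) : pairZ L ((pairDag L ^ M) vacuum) =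
    ((Fintype.card (PSite L) : ℂ) - 2 * M) • (pairDag L ^ M) vacuum := by
  induction M with
  | zero =>
    have : ∀ (i : Site L) (σ : Spin), n i σ vacuum = 0 := by
      intro i σ
      rw [n, numOf_eq, Module.End.mul_apply, c, annih_vacuum, map_zero]
    simp [pairZ, LinearMap.sum_apply, this, ← Nat.cast_smul_eq_nsmul ℂ]
  | succ M ih =>
    have h := LinearMap.congr_fun (pairZ_mul_pairDag (L := L)) ((pairDag L ^ M) vacuum)
    simp only [Module.End.mul_apply, LinearMap.sub_apply, LinearMap.smul_apply, ih, map_smul] at h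
    rw [pow_succ', Module.End.mul_apply, h, ← sub_smul]
    congr 1
    push_cast
    ring

theorem star_pairDag_pairDag_pow_vacuum (M : ℕ) :
    star (pairDag L) ((pairDag L ^ (M + 1)) vacuum) =
      (((M : ℂ) + 1) * ((Fintype.card (PSite L) : ℂ) - M)) • (pairDag L ^ M) vacuum := by
  have hs : ∀ M : ℕ, star (pairDag L) ((pairDag L ^ (M + 1)) vacuum) =
      pairDag L (star (pairDag L) ((pairDag L ^ M) vacuum)) +
        ((Fintype.card (PSite L) : ℂ) - 2 * M) • (pairDag L ^ M) vacuum := by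
    intro M
    have h := LinearMap.congr_fun (star_pairDag_mul_pairDag (L := L)) ((pairDag L ^ M) vacuum)
    simp only [Module.End.mul_apply, LinearMap.add_apply] at h
    rw [pow_succ', Module.End.mul_apply, h, pairZ_pairDag_pow_vacuum]
  induction M with
  | zero =>
    rw [hs 0, pow_zero]
    have : star (pairDag L) vacuum = 0 := by
      rw [star_pairDag, LinearMap.sum_apply]
      refine Finset.sum_eq_zero fun u _ => ?_
      rw [LinearMap.smul_apply, Module.End.mul_apply,
        show c (.inr u) true vacuum = 0 from annih_vacuum _, map_zero, smul_zero]
    simp [this]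
  | succ M ih =>
    rw [hs (M + 1), ih, map_smul, ← Module.End.mul_apply (pairDag L), ← pow_succ', ← add_smul]
    congr 1
    push_cast
    ring

theorem pairDag_pow_vacuum_ne_zero {M : ℕ} (hM : M ≤ Fintype.card (PSite L)) :
    (pairDag L ^ M) (vacuum : Fk L) ≠ 0 := by
  induction M with
  | zero => simp [vacuum]
  | succ M ih =>
    intro h
    have h1 := star_pairDag_pairDag_pow_vacuum (L := L) M
    rw [h, map_zero, eq_comm, smul_eq_zero] at h1
    refine h1.elim ?_ (ih (by omega))
    refine mul_ne_zero (by exact_mod_cast Nat.succ_ne_zero M) (sub_ne_zero.mpr ?_)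
    exact_mod_cast (show Fintype.card (PSite L) ≠ M by omega)

theorem projD_zetaDag_pow_vacuum_ne_zero (α : ℝ) {M : ℕ} (hM : M ≤ Fintype.card (PSite L)) :
    projD L ((zetaDag L α ^ M) vacuum) ≠ 0 := by
  intro h
  rw [zetaDag_pow_vacuum, projD_eq] at h
  have h1 := isDecreasingOnD_noDouble.proj_eq_zero_of_proj_dress α h
  rw [← projD_eq, projD_pairDag_pow_vacuum] at h1
  exact pairDag_pow_vacuum_ne_zero hM h1

end PairState

/-! ### Zero-energy states of the Hamiltonian -/

section GroundState

variable {L : ℕ} [NeZero L]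

/-- The sign in the commutator of an annihilation operator of spin `σ` with a pair creation
operator. -/
def spinSign (σ : Spin) : ℂ := if σ then 1 else -1

theorem lin_mul_zetaDag (α : ℝ) (g : Site L → ℂ) (σ : Spin) : lin g σ * zetaDag L α =
    zetaDag L α * lin g σ + spinSign σ •
      ∑ u : PSite L, (phase u * ∑ i, g i * star (aCoef α u i)) • star (a α u (!σ)) := by
  have key : ∀ u, lin g σ * (star (a α u true) * star (a α u false)) =
      star (a α u true) * star (a α u false) * lin g σ +
        spinSign σ • (∑ i, g i * star (aCoef α u i)) • star (a α u (!σ)) := by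
    intro u
    simp only [a_eq_lin]
    cases σ
    · rw [← mul_assoc, lin_mul_star_lin_of_ne _ _ (by simp), neg_mul, mul_assoc, lin_mul_star_lin,
        mul_sub, mul_smul_comm, mul_one, mul_assoc]
      simp [spinSign, sub_eq_add_neg]
    · rw [← mul_assoc, lin_mul_star_lin, sub_mul, smul_mul_assoc, one_mul, mul_assoc,
        lin_mul_star_lin_of_ne _ _ (by simp), mul_neg, sub_neg_eq_add, add_comm, mul_assoc]
      simp [spinSign]
  rw [zetaDag_eq, Finset.mul_sum, Finset.sum_mul, Finset.smul_sum, ← Finset.sum_add_distrib]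
  refine Finset.sum_congr rfl fun u _ => ?_
  rw [mul_smul_comm, key, smul_add, smul_mul_assoc, smul_comm (phase u) (spinSign σ),
    smul_smul (phase u)]

theorem c_inr_mul_zetaDag (α : ℝ) (v : PSite L) (σ : Spin) : c (.inr v) σ * zetaDag L α =
    zetaDag L α * c (.inr v) σ + (spinSign σ * phase v) • star (a α v (!σ)) := by
  rw [c_eq_lin, lin_mul_zetaDag]
  congr 1
  simp [Pi.single_apply, aCoef, mul_smul, apply_ite, ite_smul]

theorem c_inl_mul_zetaDag (α : ℝ) (x : DSite L) (σ : Spin) : c (.inl x) σ * zetaDag L α =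
    zetaDag L α * c (.inl x) σ + (spinSign σ * α) • star (d α x (!σ)) := by
  rw [c_eq_lin, lin_mul_zetaDag]
  congr 1
  rw [star_d, mul_smul, nbrs, Finset.sum_filter, Finset.smul_sum (r := (α : ℂ))]
  refine congrArg (fun T : Op L => spinSign σ • T) (Finset.sum_congr rfl fun u _ => ?_)
  by_cases h : x ∈ endpoints u <;> simp [Pi.single_apply, aCoef, smul_smul, mul_comm, h]

theorem sum_c_inr_mul_zetaDag (α : ℝ) (x : DSite L) (σ : Spin) :
    (∑ u ∈ nbrs x, c (.inr u) σ) * zetaDag L α =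
      zetaDag L α * ∑ u ∈ nbrs x, c (.inr u) σ + spinSign σ • star (d α x (!σ)) := by
  simp only [Finset.sum_mul, Finset.mul_sum, c_inr_mul_zetaDag, Finset.sum_add_distrib, star_d,
    Finset.smul_sum, smul_smul]

theorem commute_star_lin_zetaDag (α : ℝ) (g : Site L → ℂ) (σ : Spin) :
    Commute (star (lin g σ)) (zetaDag L α) := by
  rw [zetaDag_eq]
  refine Commute.sum_right _ _ _ fun u _ => Commute.smul_right ?_ _
  rw [a_eq_lin, a_eq_lin]
  exact (commute_mul_of_anticommute (star_lin_mul_star_lin _ _ _ _)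
    (star_lin_mul_star_lin _ _ _ _)).symm

/-- If `T` annihilates the vacuum, and `R` annihilates the commutator of `T` with `Z`, then `R T`
annihilates all powers of `Z` applied to the vacuum. -/
theorem mul_pow_vacuum_eq_zero {R T Z : Op L} (hR : Commute R Z) {z : ℂ}
    (hT : T * Z = Z * T + z • R) (hRR : R * R = 0) (h0 : T vacuum = 0) (M : ℕ) :
    (R * T * Z ^ M) vacuum = 0 := by
  induction M with
  | zero => simp [h0]
  | succ M ih =>
    have : R * T * Z ^ (M + 1) = Z * (R * T * Z ^ M) := by
      rw [pow_succ', ← mul_assoc, mul_assoc R T Z, hT, mul_add, mul_smul_comm, hRR, smul_zero,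
        add_zero, ← mul_assoc, hR.eq]
      simp only [mul_assoc]
    rw [this, Module.End.mul_apply, ih, map_zero]

theorem bondOp_zetaDag_pow_vacuum (p : Params) (u : PSite L) (σ : Spin) (M : ℕ) :
    bondOp p u σ ((zetaDag L p.α ^ M) vacuum) = 0 := by
  have h := mul_pow_vacuum_eq_zero (R := star (a p.α u (!σ))) (T := c (.inr u) σ)
    (by rw [a_eq_lin]; exact commute_star_lin_zetaDag _ _ _) (c_inr_mul_zetaDag p.α u σ)
    (by rw [a_eq_lin, star_lin_mul_self]) (annih_vacuum _) M
  have h1 : bondOp p u σ = projD L * (star (a p.α u (!σ)) * c (.inr u) σ) := by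
    rw [bondOp, mul_assoc, ← (commute_projD_c_inr u σ).eq, ← mul_assoc, a_eq_lin,
      lowers_projD_star_lin, mul_assoc]
  rw [h1, Module.End.mul_apply, ← Module.End.mul_apply (_ * _), h, map_zero]

theorem siteOp_zetaDag_pow_vacuum (hL : 3 ≤ L) (p : Params) (x : DSite L) (σ : Spin) (M : ℕ) :
    siteOp p x σ ((zetaDag L p.α ^ M) vacuum) = 0 := by
  have hd : star (d p.α x (!σ)) * star (d p.α x (!σ)) = 0 := by rw [d_eq_lin, star_lin_mul_self]
  have hdc : Commute (star (d p.α x (!σ))) (zetaDag L p.α) := by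
    rw [d_eq_lin]
    exact commute_star_lin_zetaDag _ _ _
  have hlow : projD L * star (d p.α x (!σ)) * projD L = projD L * star (d p.α x (!σ)) := by
    rw [d_eq_lin, lowers_projD_star_lin]
  have hD := mul_pow_vacuum_eq_zero hdc (c_inl_mul_zetaDag p.α x σ) hd (annih_vacuum _) M
  have hP := mul_pow_vacuum_eq_zero hdc (sum_c_inr_mul_zetaDag p.α x σ) hd (by
    rw [LinearMap.sum_apply]
    exact Finset.sum_eq_zero fun u _ => annih_vacuum _) M
  have hn : Commute (star (d p.α x (!σ))) (1 - n (.inl x) (!σ)) := by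
    refine (Commute.one_right _).sub_right (Commute.symm ?_)
    refine commute_star_of_commute (by rw [n, star_numOf]) ?_
    rw [d_eq_lin]
    exact commute_n_lin _ (dCoef_inl_self hL _ _) _ _
  have hc : projD L * (∑ u ∈ nbrs x, c (.inr u) σ) = (∑ u ∈ nbrs x, c (.inr u) σ) * projD L :=
    (Commute.sum_right _ _ _ fun u _ => commute_projD_c_inr u σ).eq
  -- The blocking of the D-site `x` commutes with `d†` because the orbital `d` vanishes at `x`.
  have h1 : projD L * star (d p.α x (!σ)) * c (.inl x) σ * projD L =
      (1 - n (.inl x) (!σ)) * projD L * (star (d p.α x (!σ)) * c (.inl x) σ) := by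
    have hnP : Commute (projD L) (1 - n (.inl x) (!σ)) :=
      (Commute.one_right _).sub_right (commute_projD_n _ _)
    calc _ = projD L * star (d p.α x (!σ)) * (projD L * c (.inl x) σ * projD L) := by
          nth_rewrite 1 [← hlow]
          simp only [mul_assoc]
      _ = projD L * star (d p.α x (!σ)) * projD L * (1 - n (.inl x) (!σ)) * c (.inl x) σ := by
          rw [projD_mul_c_inl_mul_projD, proj_noDoubleEmptyAt]
          simp only [mul_assoc]
      _ = projD L * (star (d p.α x (!σ)) * (1 - n (.inl x) (!σ))) * c (.inl x) σ := by
          rw [hlow]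
          simp only [mul_assoc]
      _ = _ := by
          rw [hn.eq, ← mul_assoc (projD L), hnP.eq]
          simp only [mul_assoc]
  have h2 : projD L * star (d p.α x (!σ)) * (∑ u ∈ nbrs x, c (.inr u) σ) * projD L =
      projD L * (star (d p.α x (!σ)) * ∑ u ∈ nbrs x, c (.inr u) σ) := by
    rw [mul_assoc, ← hc, ← mul_assoc, hlow, mul_assoc]
  have h3 : siteOp p x σ =
      (1 - n (.inl x) (!σ)) * projD L * (star (d p.α x (!σ)) * c (.inl x) σ) +
        (p.β : ℂ) • (projD L * (star (d p.α x (!σ)) * ∑ u ∈ nbrs x, c (.inr u) σ)) := by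
    rw [siteOp, b, mul_add, add_mul, h1, mul_smul_comm, smul_mul_assoc, h2]
  rw [h3, LinearMap.add_apply, LinearMap.smul_apply, Module.End.mul_apply (_ * _),
    ← Module.End.mul_apply (star _ * _), hD, map_zero, zero_add, Module.End.mul_apply (projD L),
    ← Module.End.mul_apply (star _ * _), hP, map_zero, smul_zero]

theorem lowers_projD_zetaDag (α : ℝ) : Lowers (projD L) (zetaDag L α) := by
  rw [zetaDag_eq]
  refine Lowers.sum fun u _ => Lowers.smul _ ?_
  rw [a_eq_lin, a_eq_lin]
  exact (lowers_projD_star_lin _ _).mul (lowers_projD_star_lin _ _)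

theorem projD_mul_zetaDag_pow_vacuum (α : ℝ) (M : ℕ) :
    ((projD L * zetaDag L α) ^ M) vacuum = projD L ((zetaDag L α ^ M) vacuum) := by
  induction M with
  | zero => simp [projD_vacuum]
  | succ M ih =>
    rw [pow_succ', Module.End.mul_apply, ih, pow_succ', Module.End.mul_apply _ (zetaDag L α ^ M)]
    exact LinearMap.congr_fun (lowers_projD_zetaDag α) _

theorem hasCharge_zetaDag (α : ℝ) : HasCharge 2 (zetaDag L α) := by
  rw [zetaDag_eq]
  refine HasCharge.sum fun u _ => HasCharge.smul _ ?_
  rw [a_eq_lin, a_eq_lin]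
  simpa only [one_add_one_eq_two] using
    (hasCharge_star_lin (aCoef α u) true).mul (hasCharge_star_lin (aCoef α u) false)

theorem projD_zetaDag_pow_vacuum_mem_hilbert (α : ℝ) (M : ℕ) :
    projD L ((zetaDag L α ^ M) vacuum) ∈ hilbert L (M + M) := by
  refine mem_hilbert_iff.mpr ⟨LinearMap.congr_fun projD_mul_self _, ?_⟩
  have h := (hasCharge_projD.mul ((hasCharge_zetaDag (L := L) α).pow M)).apply
    (ψ := vacuum) (z := 0) (by rw [totalNum_vacuum, zero_smul])
  rw [Module.End.mul_apply] at h
  rw [h]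
  congr 1
  push_cast
  ring

theorem sosHamiltonian_projD_zetaDag_pow_vacuum (hL : 3 ≤ L) {p : Params} (hV₁ : 0 < p.V₁)
    (hV₂ : 0 < p.V₂) (M : ℕ) :
    sosHamiltonian p (projD L ((zetaDag L p.α ^ M) vacuum)) = 0 := by
  rw [sosHamiltonian_eq_zero_iff hV₁ hV₂]
  constructor
  · intro x σ
    have : siteOp p x σ * projD L = siteOp p x σ := by
      rw [siteOp, mul_assoc, projD_mul_self]
    rw [← Module.End.mul_apply, this, siteOp_zetaDag_pow_vacuum hL]
  · intro u σ
    have : bondOp p u σ * projD L = bondOp p u σ := by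
      rw [bondOp, mul_assoc, projD_mul_self]
    rw [← Module.End.mul_apply, this, bondOp_zetaDag_pow_vacuum]

/-- A nonzero zero-energy state has an even number of electrons, and undressing it produces a state
in which all pair configurations occur. -/
theorem even_and_undress_ne_zero {p : Params} (hαβ : p.α ≠ -p.β) (hV₁ : 0 < p.V₁)
    (hV₂ : 0 < p.V₂) {N : ℕ} (hN : N ≤ 2 * Fintype.card (PSite L)) {Ψ : Fk L}
    (hΨ : Ψ ∈ hilbert L N) (h : sosHamiltonian p Ψ = 0) (h0 : Ψ ≠ 0) :
    Even N ∧ ∀ B : Finset (PSite L), 2 * B.card = N →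
      projD L (undress L p.α Ψ) (pairConfig B) ≠ 0 := by
  rw [mem_hilbert_iff] at hΨ
  obtain ⟨h1, h2⟩ := (sosHamiltonian_eq_zero_iff hV₁ hV₂).mp h
  have hred := isReduced_undress hΨ.1 h1 h2
  refine hred.even_and_pairConfig_ne_zero ?_ hN ?_ ?_
  · rw [← Complex.ofReal_add, Complex.ofReal_ne_zero]
    exact fun h => hαβ (eq_neg_of_add_eq_zero_left h)
  · rw [← totalNum_eq_iff]
    simpa using hasCharge_projD.apply ((hasCharge_undress p.α).apply hΨ.2)
  · intro h3
    have := projD_dress_projD_undress p.α hΨ.1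
    rw [h3, map_zero, map_zero] at this
    exact h0 this.symm

/-- Zero-energy states with the same number of electrons are proportional: a combination with
vanishing amplitude on one pair configuration is zero. -/
theorem exists_eq_smul_of_sosHamiltonian_eq_zero {p : Params} (hαβ : p.α ≠ -p.β)
    (hV₁ : 0 < p.V₁) (hV₂ : 0 < p.V₂) {N : ℕ} (hN : N ≤ 2 * Fintype.card (PSite L))
    {Φ Ψ : Fk L} (hΦ : Φ ∈ hilbert L N) (hHΦ : sosHamiltonian p Φ = 0) (h0 : Φ ≠ 0)
    (hΨ : Ψ ∈ hilbert L N) (hHΨ : sosHamiltonian p Ψ = 0) : ∃ z : ℂ, Ψ = z • Φ := by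
  obtain ⟨⟨M, hM⟩, hB⟩ := even_and_undress_ne_zero hαβ hV₁ hV₂ hN hΦ hHΦ h0
  obtain ⟨B, -, hBc⟩ := Finset.exists_subset_card_eq
    (s := (Finset.univ : Finset (PSite L))) (n := M) (by rw [Finset.card_univ]; omega)
  set χ : Fk L → ℂ := fun Ψ => projD L (undress L p.α Ψ) (pairConfig B) with hχ
  have hχΦ : χ Φ ≠ 0 := hB B (by omega)
  refine ⟨χ Ψ / χ Φ, ?_⟩
  by_contra hne
  refine (even_and_undress_ne_zero hαβ hV₁ hV₂ hN
    (Submodule.sub_mem _ hΨ (Submodule.smul_mem _ (χ Ψ / χ Φ) hΦ)) ?_ (sub_ne_zero.mpr hne)).2 B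
    (by omega) ?_
  · rw [map_sub, map_smul, hHΦ, hHΨ, smul_zero, sub_zero]
  · rw [map_sub, map_sub, map_smul, map_smul, PiLp.sub_apply, PiLp.smul_apply, smul_eq_mul]
    exact sub_eq_zero.mpr (div_mul_cancel₀ _ hχΦ).symm

end GroundState

end CuO2

theorem theorem1 (L : ℕ) [NeZero L] (hL : 3 ≤ L) (p : CuO2.Params)
    (hαβ : p.α ≠ -p.β) (hV₁ : 0 < p.V₁) (hV₂ : 0 < p.V₂)
    (ht : p.t = 4 * (1 + p.α ^ 2) * p.V₁) (hW₁ : p.W₁ = p.α ^ 2 * p.V₁)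
    (hs : p.s = (1 + 2 * p.α ^ 2) * p.V₂) (hW₂ : p.W₂ = p.α ^ 2 * p.V₂)
    (N : ℕ) (hN : N ≤ 2 * Fintype.card (CuO2.PSite L)) :
    (Even N → ∃ Φ : CuO2.Fk L,
      Φ = (CuO2.projD L * CuO2.zetaDag L p.α ^ (N / 2)) CuO2.vacuum ∧
      Φ = ((CuO2.projD L * CuO2.zetaDag L p.α) ^ (N / 2)) CuO2.vacuum ∧
      CuO2.H L p Φ = 0 ∧
      CuO2.IsGroundEnergy L p N 0 ∧
      CuO2.IsGroundState p N Φ ∧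
      ∀ Ψ : CuO2.Fk L, CuO2.IsGroundState p N Ψ → ∃ z : ℂ, Ψ = z • Φ) ∧
    (Odd N → ∃ E : ℝ, CuO2.IsGroundEnergy L p N E ∧ 0 < E) := by
  have hH : CuO2.H L p = CuO2.sosHamiltonian p := CuO2.H_eq_sum hL p ht hW₁ hs hW₂
  constructor
  · intro hNe
    obtain ⟨M, hM⟩ := hNe
    have hM2 : N / 2 = M := by omega
    set Φ : CuO2.Fk L := CuO2.projD L ((CuO2.zetaDag L p.α ^ M) CuO2.vacuum) with hΦ
    have hmem : Φ ∈ CuO2.hilbert L N := by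
      rw [hM]
      exact CuO2.projD_zetaDag_pow_vacuum_mem_hilbert p.α M
    have hne : Φ ≠ 0 := CuO2.projD_zetaDag_pow_vacuum_ne_zero p.α (by omega)
    have hzero : CuO2.sosHamiltonian p Φ = 0 :=
      CuO2.sosHamiltonian_projD_zetaDag_pow_vacuum hL hV₁ hV₂ M
    have hE : CuO2.IsGroundEnergy L p N 0 := by
      refine ⟨⟨Φ, hmem, hne, ?_⟩, ?_⟩
      · rw [hH, hzero, Complex.ofReal_zero, zero_smul]
      · rintro E ⟨Ψ, -, hΨ, hHΨ⟩
        rw [hH] at hHΨ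
        exact CuO2.eigenvalue_nonneg hV₁ hV₂ hΨ hHΨ
    refine ⟨Φ, ?_, ?_, ?_, hE, ⟨hmem, hne, 0, hE, ?_⟩, ?_⟩
    · rw [hM2]
      rfl
    · rw [hM2, CuO2.projD_mul_zetaDag_pow_vacuum]
    · rw [hH, hzero]
    · rw [hH, hzero, Complex.ofReal_zero, zero_smul]
    · rintro Ψ ⟨hΨ, -, E, hE', hHΨ⟩
      rw [hE'.unique hE, hH, Complex.ofReal_zero, zero_smul] at hHΨ
      exact CuO2.exists_eq_smul_of_sosHamiltonian_eq_zero hαβ hV₁ hV₂ hN hmem hzero hne hΨ hHΨ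
  · intro hNo
    obtain ⟨E, hE⟩ := CuO2.exists_isLeast_eigenvalue p hN
    refine ⟨E, by rwa [CuO2.IsGroundEnergy, hH], ?_⟩
    obtain ⟨Φ, hΦ, hne, hHΦ⟩ := hE.1
    refine lt_of_le_of_ne (CuO2.eigenvalue_nonneg hV₁ hV₂ hne hHΦ) ?_
    rintro rfl
    rw [Complex.ofReal_zero, zero_smul] at hHΦ
    exact Nat.not_even_iff_odd.mpr hNo
      (CuO2.even_and_undress_ne_zero hαβ hV₁ hV₂ hN hΦ hHΦ hne).1
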